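/- Let $N$ and $H$ be discrete groups, let $H$ act on $N$ by automorphisms, and let $G=N\rtimes H$ be the semidirect product, in which $ana^{-1}$ ($a\in H$, $n\in N$) is the image of $n$ under $a$. Let $M\neq\{e\}$ be a normal subgroup of $N$ and let $\mathcal U=\{aMa^{-1}:a\in H\}$. Assume that for all $U,V\in\mathcal U$ there is $W\in\mathcal U$ with $W\subseteq U\cap V$, that $\bigcap_{U\in\mathcal U}U=\{e\}$, and that $|U/V|<\infty$ whenever $V\subseteq U$ in $\mathcal U$. Put $H^+=\{a\in H: aMa^{-1}\subseteq M\}$, and assume moreover that $H$ is abelian and $N=\bigcup_{a\in H^+}a^{-1}Ma$. Let $D\subseteq\ell^\infty(N)$ be the $C^*$-subalgebra generated by the characteristic functions $\chi_{xU}$ ($x\in N$, $U\in\mathcal U$), with the action $\alpha$ of $G$ given by $(\alpha_{xa}f)(y)=f\bigl(a^{-1}x^{-1}y\,a\bigr)$ for $x,y\in N$, $a\in H$. Let $A=D\rtimes_\alpha G$ be the full crossed product, and regard $D$ as a subalgebra of $A$ and $G$ as mapped canonically into the unitary group of the multiplier algebra of $A$. Let $p=\chi_M\in A$; the corner $pAp$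 is a unital $C^*$-algebra with unit $p$. Put $s_a=pap$ for $a\in H^+$ and $u(m)=pmp$ for $m\in M$. An SU-family in a unital $C^*$-algebra $B$ consists of isometries $S_a\in B$ ($a\in H^+$) and unitaries $U(m)\in B$ ($m\in M$) such that for all $a,b\in H^+$ and $m,k\in M$ \[ S_aS_b=S_{ab},\qquad S_aU(m)=U(ama^{-1})S_a,\qquad U(m)U(k)=U(mk),\qquad \sum_{m\,aMa^{-1}\in M/aMa^{-1}}U(m)S_aS_a^*U(m^{-1})=1 \] (by the other relations the terms of the last sum depend only on the cosets $m\,aMa^{-1}$). Then $pAp$ is the universal $C^*$-algebra for SU-families: $\{s_a,u(m):a\in H^+,m\in M\}$ is an SU-family in $pAp$ that generates $pAp$ as a $C^*$-algebra, and for every SU-family $\{S_a,U(m)\}$ in a unital $C^*$-algebra $B$ there is a unique $*$-homomorphism $\Pi:pAp\to B$ such that $\Pi(s_a)=S_a$ for all $a\in H^+$ and $\Pi(u(m))=U(m)$ for all $m\in M$. -/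

import Mathlib

/-! ### The full crossed product of a C⋆-algebra by an action of a discrete group -/

/-- The `*`-algebra `C_c(G, D)` of finitely supported functions `G → D`. The function `f` is thought
of as the formal sum `∑ s, f s · s`; the action `α` enters through the product and the involution,
`(d · s) (e · t) = d α_s(e) · st` and `(d · s)^* = α_{s⁻¹}(d^*) · s⁻¹`. -/
def CovAlg {G : Type*} {D : Type*} [Group G] [NonUnitalCStarAlgebra D]
    (_α : G →* (D ≃⋆ₐ[ℂ] D)) : Type _ := G →₀ D

noncomputable section

namespace CovAlg

variable {G : Type*} {D : Type*} [Group G] [NonUnitalCStarAlgebra D] (α : G →* (D ≃⋆ₐ[ℂ] D))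

instance : AddCommGroup (CovAlg α) := inferInstanceAs (AddCommGroup (G →₀ D))
instance : Module ℂ (CovAlg α) := inferInstanceAs (Module ℂ (G →₀ D))

/-- The formal monomial `d · s`. -/
def single (s : G) (d : D) : CovAlg α := Finsupp.single s d

/-- Linear maps out of `C_c(G, D)` are given by linear maps on the coefficients. -/
def lift {E : Type*} [AddCommGroup E] (F : G → D →+ E) : CovAlg α →+ E :=
  Finsupp.liftAddHom F

variable {α}

@[simp] theorem lift_single {E : Type*} [AddCommGroup E] (F : G → D →+ E) (s : G) (d : D) :
    lift α F (single α s d) = F s d := by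
  exact Finsupp.liftAddHom_apply_single F s d

theorem single_add (s : G) (d e : D) : single α s (d + e) = single α s d + single α s e :=
  Finsupp.single_add s d e

@[simp] theorem single_zero (s : G) : single α s 0 = 0 := Finsupp.single_zero s

theorem smul_single (c : ℂ) (s : G) (d : D) : c • single α s d = single α s (c • d) :=
  Finsupp.smul_single c s d

theorem induction {P : CovAlg α → Prop} (f : CovAlg α) (h0 : P 0)
    (hadd : ∀ f g, P f → P g → P (f + g)) (hs : ∀ s d, P (single α s d)) : P f :=
  Finsupp.induction_linear (motive := P) f h0 hadd hs

variable (α)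

/-- The biadditive extension of `(d · s) (e · t) = (d * α_s e) · st`. -/
def mulHom : CovAlg α →+ CovAlg α →+ CovAlg α :=
  lift α fun s =>
    { toFun := fun d => lift α fun t =>
        { toFun := fun e => single α (s * t) (d * α s e)
          map_zero' := by simp
          map_add' := fun e e' => by rw [map_add, mul_add, single_add] }
      map_zero' := by
        ext f
        induction f using CovAlg.induction with
        | h0 => simp
        | hadd f g hf hg => rw [map_add, hf, hg, map_add]
        | hs s d => simp
      map_add' := fun d d' => by
        ext f
        induction f using CovAlg.induction with
        | h0 => simp
        | hadd f g hf hg => rw [map_add, hf, hg, map_add]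
        | hs s d => simp [add_mul, single_add] }

/-- The additive extension of `(d · s)^* = α_{s⁻¹}(d^*) · s⁻¹`. -/
def starHom : CovAlg α →+ CovAlg α :=
  lift α fun s =>
    { toFun := fun d => single α s⁻¹ (α s⁻¹ (star d))
      map_zero' := by simp
      map_add' := fun d d' => by rw [star_add, map_add, single_add] }

instance : Mul (CovAlg α) := ⟨fun f g => mulHom α f g⟩

instance : Star (CovAlg α) := ⟨fun f => starHom α f⟩

variable {α}

theorem single_mul_single (s t : G) (d e : D) :
    single α s d * single α t e = single α (s * t) (d * α s e) := by
  change mulHom α _ _ = _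
  simp [mulHom]

theorem star_single (s : G) (d : D) :
    star (single α s d) = single α s⁻¹ (α s⁻¹ (star d)) := by
  change starHom α _ = _
  simp [starHom]

theorem mul_add' (f g h : CovAlg α) : f * (g + h) = f * g + f * h :=
  map_add (mulHom α f) g h

theorem add_mul' (f g h : CovAlg α) : (f + g) * h = f * h + g * h := by
  change mulHom α (f + g) h = mulHom α f h + mulHom α g h
  rw [map_add]; rfl

theorem zero_mul' (f : CovAlg α) : 0 * f = 0 := by
  change mulHom α 0 f = 0
  rw [map_zero]; rfl

theorem mul_zero' (f : CovAlg α) : f * 0 = 0 := map_zero (mulHom α f)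

theorem star_add' (f g : CovAlg α) : star (f + g) = star f + star g :=
  map_add (starHom α) f g

theorem star_zero' : star (0 : CovAlg α) = 0 := map_zero (starHom α)

instance : NonUnitalRing (CovAlg α) where
  left_distrib := mul_add'
  right_distrib := add_mul'
  zero_mul := zero_mul'
  mul_zero := mul_zero'
  mul_assoc f g h := by
    induction f using CovAlg.induction with
    | h0 => simp only [zero_mul']
    | hadd f f' hf hf' => simp only [add_mul', hf, hf']
    | hs s d =>
      induction g using CovAlg.induction with
      | h0 => simp only [zero_mul', mul_zero']
      | hadd f f' hf hf' => simp only [add_mul', mul_add', hf, hf']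
      | hs t e =>
        induction h using CovAlg.induction with
        | h0 => simp only [mul_zero']
        | hadd f f' hf hf' => simp only [mul_add', hf, hf']
        | hs u c => simp [single_mul_single, mul_assoc]

instance : StarRing (CovAlg α) where
  star_add := star_add'
  star_involutive f := by
    induction f using CovAlg.induction with
    | h0 => simp only [star_zero']
    | hadd f f' hf hf' => simp only [star_add', hf, hf']
    | hs s d => 
      simp only [star_single, ← map_star, star_star, inv_inv]
      rw [← StarAlgEquiv.mul_apply, ← map_mul]; simp
  star_mul f g := by
    induction f using CovAlg.induction with
    | h0 => simp only [zero_mul, mul_zero, star_zero']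
    | hadd f f' hf hf' => simp only [add_mul, mul_add, star_add', hf, hf']
    | hs s d =>
      induction g using CovAlg.induction with
      | h0 => simp only [zero_mul, mul_zero, star_zero']
      | hadd f f' hf hf' => simp only [add_mul, mul_add, star_add', hf, hf']
      | hs t e =>
        simp only [single_mul_single, star_single, star_mul, map_mul, mul_inv_rev,
          StarAlgEquiv.mul_apply, ← map_star]
        congr 2
        rw [← StarAlgEquiv.mul_apply (α s⁻¹), ← map_mul]; simp

instance : IsScalarTower ℂ (CovAlg α) (CovAlg α) where
  smul_assoc c f g := by
    simp only [smul_eq_mul]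
    induction f using CovAlg.induction with
    | h0 => simp
    | hadd f f' hf hf' => simp only [add_mul, smul_add, hf, hf']
    | hs s d =>
      induction g using CovAlg.induction with
      | h0 => simp
      | hadd f f' hf hf' => simp only [mul_add, smul_add, hf, hf']
      | hs t e => simp [smul_single, single_mul_single, smul_mul_assoc]

instance : SMulCommClass ℂ (CovAlg α) (CovAlg α) where
  smul_comm c f g := by
    simp only [smul_eq_mul]
    induction f using CovAlg.induction with
    | h0 => simp
    | hadd f f' hf hf' => simp only [add_mul, smul_add, hf, hf']
    | hs s d =>
      induction g using CovAlg.induction with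
      | h0 => simp
      | hadd f f' hf hf' => simp only [mul_add, smul_add, hf, hf']
      | hs t e => simp [smul_single, single_mul_single, mul_smul_comm]

instance : StarModule ℂ (CovAlg α) where
  star_smul c f := by
    induction f using CovAlg.induction with
    | h0 => simp
    | hadd f f' hf hf' => simp only [star_add, smul_add, hf, hf']
    | hs s d => simp [smul_single, star_single]

/-- The `ℓ¹`-norm `∑ s, ‖f s‖`. -/
def l1Norm (f : CovAlg α) : ℝ := Finsupp.sum (f : G →₀ D) fun _ d => ‖d‖

end CovAlg

/-- The C⋆-seminorms on `C_c(G, D)` that are dominated by the `ℓ¹`-norm. These are exactly the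
functions `f ↦ ‖∑ s, π (f s) u_s‖` for covariant representations `(π, u)` of `(D, G)`: such a
representation gives a seminorm of this kind, and conversely the completion in such a seminorm is
a C⋆-algebra whose faithful nondegenerate representations come from covariant representations. -/
structure CStarSeminorm {G : Type*} {D : Type*} [Group G] [NonUnitalCStarAlgebra D]
    (α : G →* (D ≃⋆ₐ[ℂ] D)) extends Seminorm ℂ (CovAlg α) where
  mul_le' : ∀ f g, toFun (f * g) ≤ toFun f * toFun g
  star_mul_self' : ∀ f, toFun (star f * f) = toFun f ^ 2
  le_l1Norm' : ∀ f, toFun f ≤ CovAlg.l1Norm f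

namespace CStarSeminorm

variable {G : Type*} {D : Type*} [Group G] [NonUnitalCStarAlgebra D] {α : G →* (D ≃⋆ₐ[ℂ] D)}

instance : CoeFun (CStarSeminorm α) fun _ => CovAlg α → ℝ := ⟨fun q => q.toSeminorm⟩

instance : Nonempty (CStarSeminorm α) :=
  ⟨{ (0 : Seminorm ℂ (CovAlg α)) with
      mul_le' := fun _ _ => (zero_mul (0 : ℝ)).ge
      star_mul_self' := fun _ => (zero_pow (M₀ := ℝ) two_ne_zero).symm
      le_l1Norm' := fun _ => Finset.sum_nonneg fun _ _ => norm_nonneg _ }⟩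

theorem bdd (f : CovAlg α) : BddAbove (Set.range fun q : CStarSeminorm α => q f) :=
  ⟨CovAlg.l1Norm f, by rintro _ ⟨q, rfl⟩; exact q.le_l1Norm' f⟩

theorem mul_le (q : CStarSeminorm α) (f g : CovAlg α) : q (f * g) ≤ q f * q g := q.mul_le' f g

theorem star_mul_self (q : CStarSeminorm α) (f : CovAlg α) : q (star f * f) = q f ^ 2 :=
  q.star_mul_self' f

theorem star_eq (q : CStarSeminorm α) (f : CovAlg α) : q (star f) = q f := by
  have key : ∀ f : CovAlg α, q f ≤ q (star f) := fun f => by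
    have h := q.star_mul_self f
    have h' := q.mul_le (star f) f
    have h0 : 0 ≤ q f := apply_nonneg q.toSeminorm f
    have h1 : 0 ≤ q (star f) := apply_nonneg q.toSeminorm _
    by_contra! hlt
    nlinarith
  exact le_antisymm (by simpa using key (star f)) (key f)

end CStarSeminorm

namespace CovAlg

variable {G : Type*} {D : Type*} [Group G] [NonUnitalCStarAlgebra D] {α : G →* (D ≃⋆ₐ[ℂ] D)}

/-- The universal norm on `C_c(G, D)`: the supremum of its C⋆-seminorms, that is, of the norms of
its images under all covariant representations. -/
def univNorm (f : CovAlg α) : ℝ := ⨆ q : CStarSeminorm α, q f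

theorem le_univNorm (q : CStarSeminorm α) (f : CovAlg α) : q f ≤ univNorm f :=
  le_ciSup (CStarSeminorm.bdd f) q

theorem univNorm_nonneg (f : CovAlg α) : 0 ≤ univNorm f :=
  Real.iSup_nonneg fun q => apply_nonneg q.toSeminorm f

theorem univNorm_mul_le (f g : CovAlg α) : univNorm (f * g) ≤ univNorm f * univNorm g :=
  ciSup_le fun q => (q.mul_le f g).trans <|
    mul_le_mul (le_univNorm q f) (le_univNorm q g) (apply_nonneg q.toSeminorm g) (univNorm_nonneg f)

theorem univNorm_star (f : CovAlg α) : univNorm (star f) = univNorm f :=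
  iSup_congr fun q => q.star_eq f

theorem univNorm_sq_le (f : CovAlg α) : univNorm f * univNorm f ≤ univNorm (star f * f) := by
  have h : univNorm f ≤ √(univNorm (star f * f)) :=
    ciSup_le fun q => Real.le_sqrt_of_sq_le ((q.star_mul_self f).symm.le.trans (le_univNorm q _))
  calc _ ≤ √(univNorm (star f * f)) * √(univNorm (star f * f)) :=
        mul_self_le_mul_self (univNorm_nonneg f) h
    _ = _ := Real.mul_self_sqrt (univNorm_nonneg _)

/-- The universal norm as a seminorm. -/
def univSeminorm (α : G →* (D ≃⋆ₐ[ℂ] D)) : Seminorm ℂ (CovAlg α) :=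
  Seminorm.of univNorm
    (fun f g => ciSup_le fun q => (map_add_le_add q.toSeminorm f g).trans
      (add_le_add (le_univNorm q f) (le_univNorm q g)))
    (fun c f => by
      rw [univNorm, univNorm, Real.mul_iSup_of_nonneg (norm_nonneg c)]
      exact iSup_congr fun q => map_smul_eq_mul q.toSeminorm c f)

instance : SeminormedAddCommGroup (CovAlg α) :=
  (univSeminorm α).toAddGroupSeminorm.toSeminormedAddCommGroup

theorem norm_def (f : CovAlg α) : ‖f‖ = univNorm f := rfl

instance : NonUnitalSeminormedRing (CovAlg α) where
  __ := (inferInstance : NonUnitalRing (CovAlg α))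
  __ := (inferInstance : SeminormedAddCommGroup (CovAlg α))
  norm_mul_le := univNorm_mul_le

instance : NormedSpace ℂ (CovAlg α) where
  norm_smul_le c f := (map_smul_eq_mul (univSeminorm α) c f).le

instance : NormedStarGroup (CovAlg α) where
  norm_star_le f := (univNorm_star f).le

end CovAlg


/-- The full crossed product `D ⋊_α G`: the completion of `C_c(G, D)` in the universal
norm, in other words the enveloping C⋆-algebra of `ℓ¹(G, D)`. -/
def CrossedProduct {G : Type*} {D : Type*} [Group G] [NonUnitalCStarAlgebra D]
    (α : G →* (D ≃⋆ₐ[ℂ] D)) : Type _ := UniformSpace.Completion (CovAlg α)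

namespace CrossedProduct

open UniformSpace

variable {G : Type*} {D : Type*} [Group G] [NonUnitalCStarAlgebra D] {α : G →* (D ≃⋆ₐ[ℂ] D)}

instance : NormedAddCommGroup (CrossedProduct α) :=
  inferInstanceAs (NormedAddCommGroup (Completion (CovAlg α)))

/-- Scalar multiplication, inherited from the completion. -/
@[irreducible] def smul (c : ℂ) (x : CrossedProduct α) : CrossedProduct α :=
  @SMul.smul ℂ (Completion (CovAlg α)) _ c x

instance : SMul ℂ (CrossedProduct α) := ⟨smul⟩

theorem smul_def : (HSMul.hSMul : ℂ → CrossedProduct α → CrossedProduct α) =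
    (HSMul.hSMul : ℂ → Completion (CovAlg α) → Completion (CovAlg α)) := by
  funext c x
  change smul c x = _
  rw [smul]
  rfl

instance : NormedSpace ℂ (CrossedProduct α) where
  one_smul := by rw [smul_def]; exact one_smul (α := Completion (CovAlg α)) ℂ
  mul_smul := by rw [smul_def]; exact mul_smul (α := ℂ) (β := Completion (CovAlg α))
  smul_zero := by rw [smul_def]; exact smul_zero (M := ℂ) (A := Completion (CovAlg α))
  smul_add := by rw [smul_def]; exact smul_add (M := ℂ) (A := Completion (CovAlg α))
  add_smul := by rw [smul_def]; exact add_smul (R := ℂ) (M := Completion (CovAlg α))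
  zero_smul := by rw [smul_def]; exact zero_smul (A := Completion (CovAlg α)) ℂ
  norm_smul_le := by
    rw [smul_def]; exact norm_smul_le (α := ℂ) (β := Completion (CovAlg α))

instance : CompleteSpace (CrossedProduct α) :=
  inferInstanceAs (CompleteSpace (Completion (CovAlg α)))

/-- The canonical map `C_c(G, D) → D ⋊_α G`. -/
def of : CovAlg α →L[ℂ] CrossedProduct α where
  toFun f := (f : Completion (CovAlg α))
  map_add' := Completion.coe_add
  map_smul' c f := by
    change _ = c • _
    rw [smul_def]
    exact Completion.coe_smul c f
  cont := Completion.continuous_coe (CovAlg α)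

@[simp] theorem norm_of (f : CovAlg α) : ‖of f‖ = ‖f‖ := Completion.norm_coe f

theorem isDenseInducing_of : IsDenseInducing (of : CovAlg α → CrossedProduct α) :=
  Completion.isDenseInducing_coe

theorem denseRange_of : DenseRange (of : CovAlg α → CrossedProduct α) :=
  isDenseInducing_of.dense

@[elab_as_elim]
theorem induction₁ {P : CrossedProduct α → Prop} (x : CrossedProduct α)
    (hc : IsClosed {x | P x}) (h : ∀ f, P (of f)) : P x :=
  Completion.induction_on x hc h

@[elab_as_elim]
theorem induction₂ {P : CrossedProduct α → CrossedProduct α → Prop} (x y : CrossedProduct α)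
    (hc : IsClosed {p : CrossedProduct α × CrossedProduct α | P p.1 p.2})
    (h : ∀ f g, P (of f) (of g)) : P x y :=
  Completion.induction_on₂ x y hc h

@[elab_as_elim]
theorem induction₃ {P : CrossedProduct α → CrossedProduct α → CrossedProduct α → Prop}
    (x y z : CrossedProduct α)
    (hc : IsClosed {p : CrossedProduct α × CrossedProduct α × CrossedProduct α |
      P p.1 p.2.1 p.2.2})
    (h : ∀ f g k, P (of f) (of g) (of k)) : P x y z :=
  Completion.induction_on₃ x y z hc h

/-- The continuous extension of the product of `C_c(G, D)`. -/
instance : Mul (CrossedProduct α) :=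
  ⟨Function.curry <| (isDenseInducing_of.prodMap isDenseInducing_of).extend
    (fun p : CovAlg α × CovAlg α => of (p.1 * p.2))⟩

/-- The continuous extension of the involution of `C_c(G, D)`. -/
instance : Star (CrossedProduct α) :=
  ⟨Completion.map (star : CovAlg α → CovAlg α)⟩

theorem of_mul (f g : CovAlg α) : of (f * g) = of f * of g :=
  ((isDenseInducing_of.prodMap isDenseInducing_of).extend_eq
    (of.continuous.comp (continuous_mul (M := CovAlg α))) (f, g)).symm

theorem of_star (f : CovAlg α) : of (star f) = star (of f) :=
  (Completion.map_coe (star_isometry (E := CovAlg α)).uniformContinuous f).symm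

instance : ContinuousMul (CrossedProduct α) where
  continuous_mul := by
    let m := (AddMonoidHom.mul : CovAlg α →+ CovAlg α →+ CovAlg α).compr₂
      (of (α := α) : CovAlg α →+ CrossedProduct α)
    have hm : Continuous fun p : CovAlg α × CovAlg α => m p.1 p.2 :=
      of.continuous.comp continuous_mul
    have di : IsDenseInducing
      ((of (α := α) : CovAlg α →+ CrossedProduct α) : CovAlg α → CrossedProduct α) :=
      isDenseInducing_of
    exact di.extend_Z_bilin di hm

instance : ContinuousStar (CrossedProduct α) where
  continuous_star := Completion.continuous_map (f := (star : CovAlg α → CovAlg α))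

instance : NonUnitalNormedRing (CrossedProduct α) where
  __ := (inferInstance : NormedAddCommGroup (CrossedProduct α))
  zero_mul x := by
    refine induction₁ x ?_ fun f => ?_
    · exact isClosed_eq (by fun_prop) (by fun_prop)
    rw [← map_zero of, ← of_mul, zero_mul]
  mul_zero x := by
    refine induction₁ x ?_ fun f => ?_
    · exact isClosed_eq (by fun_prop) (by fun_prop)
    rw [← map_zero of, ← of_mul, mul_zero]
  mul_assoc x y z := by
    refine induction₃ x y z ?_ fun f g k => ?_
    · exact isClosed_eq (by fun_prop) (by fun_prop)
    simp only [← of_mul, mul_assoc]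
  left_distrib x y z := by
    refine induction₃ x y z ?_ fun f g k => ?_
    · exact isClosed_eq (by fun_prop) (by fun_prop)
    simp only [← of_mul, ← map_add, mul_add]
  right_distrib x y z := by
    refine induction₃ x y z ?_ fun f g k => ?_
    · exact isClosed_eq (by fun_prop) (by fun_prop)
    simp only [← of_mul, ← map_add, add_mul]
  norm_mul_le x y := by
    refine induction₂ x y ?_ fun f g => ?_
    · exact isClosed_le (by fun_prop) (by fun_prop)
    simpa only [← of_mul, norm_of] using norm_mul_le f g

instance : StarRing (CrossedProduct α) where
  star_involutive x := by
    refine induction₁ x ?_ fun f => ?_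
    · exact isClosed_eq (by fun_prop) (by fun_prop)
    simp only [← of_star, star_star]
  star_mul x y := by
    refine induction₂ x y ?_ fun f g => ?_
    · exact isClosed_eq (by fun_prop) (by fun_prop)
    simp only [← of_star, ← of_mul, star_mul]
  star_add x y := by
    refine induction₂ x y ?_ fun f g => ?_
    · exact isClosed_eq (by fun_prop) (by fun_prop)
    simp only [← of_star, ← map_add, star_add]

instance : CStarRing (CrossedProduct α) where
  norm_mul_self_le x := by
    refine induction₁ x ?_ fun f => ?_
    · exact isClosed_le (by fun_prop) (by fun_prop)
    · rw [← of_star, ← of_mul, norm_of, norm_of]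
      exact CovAlg.univNorm_sq_le f

instance : IsScalarTower ℂ (CrossedProduct α) (CrossedProduct α) where
  smul_assoc c x y := by
    simp only [smul_eq_mul]
    refine induction₂ x y ?_ fun f g => ?_
    · exact isClosed_eq (by fun_prop) (by fun_prop)
    · rw [← map_smul, ← of_mul, ← of_mul, ← map_smul, smul_mul_assoc]

instance : SMulCommClass ℂ (CrossedProduct α) (CrossedProduct α) where
  smul_comm c x y := by
    simp only [smul_eq_mul]
    refine induction₂ x y ?_ fun f g => ?_
    · exact isClosed_eq (by fun_prop) (by fun_prop)
    · rw [← map_smul, ← of_mul, ← of_mul, ← map_smul, mul_smul_comm]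

instance : StarModule ℂ (CrossedProduct α) where
  star_smul c x := by
    refine induction₁ x ?_ fun f => ?_
    · exact isClosed_eq (by fun_prop) (by fun_prop)
    · rw [← map_smul, ← of_star, ← of_star, ← map_smul, star_smul]

/-- The full crossed product is a C⋆-algebra. -/
instance : NonUnitalCStarAlgebra (CrossedProduct α) where

/-- The canonical embedding `i_D` of the coefficient algebra, `d ↦ d · 1`. -/
def iD (α : G →* (D ≃⋆ₐ[ℂ] D)) : D →⋆ₙₐ[ℂ] CrossedProduct α where
  toFun d := of (CovAlg.single α 1 d)
  map_smul' c d := by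
    change of (CovAlg.single α 1 (c • d)) = c • of (CovAlg.single α 1 d)
    rw [← map_smul, CovAlg.smul_single]
  map_zero' := by rw [CovAlg.single_zero, map_zero]
  map_add' d e := by rw [CovAlg.single_add, map_add]
  map_mul' d e := by simp [← of_mul, CovAlg.single_mul_single]
  map_star' d := by simp [← of_star, CovAlg.star_single]

theorem iD_apply (d : D) : iD α d = of (CovAlg.single α 1 d) := rfl

end CrossedProduct

namespace CovAlg

variable {G : Type*} {D : Type*} [Group G] [NonUnitalCStarAlgebra D] (α : G →* (D ≃⋆ₐ[ℂ] D))

/-- Left multiplication by the group element `g`: `e · t ↦ α_g(e) · gt`. -/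
def leftAdd (g : G) : CovAlg α →+ CovAlg α :=
  lift α fun t =>
    { toFun := fun e => single α (g * t) (α g e)
      map_zero' := by simp
      map_add' := fun e e' => by rw [map_add, single_add] }

/-- Right multiplication by the group element `g`: `e · t ↦ e · tg`. -/
def rightAdd (g : G) : CovAlg α →+ CovAlg α :=
  lift α fun t =>
    { toFun := fun e => single α (t * g) e
      map_zero' := by simp
      map_add' := fun e e' => by rw [single_add] }

variable {α}

theorem leftAdd_single (g t : G) (e : D) :
    leftAdd α g (single α t e) = single α (g * t) (α g e) := by
  simp [leftAdd]

theorem rightAdd_single (g t : G) (e : D) :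
    rightAdd α g (single α t e) = single α (t * g) e := by
  simp [rightAdd]

theorem rightAdd_mul (g : G) (f k : CovAlg α) : rightAdd α g f * k = f * leftAdd α g k := by
  induction f using CovAlg.induction with
  | h0 => simp
  | hadd f f' hf hf' => simp only [map_add, add_mul, hf, hf']
  | hs s d =>
    induction k using CovAlg.induction with
    | h0 => simp
    | hadd f f' hf hf' => simp only [map_add, mul_add, hf, hf']
    | hs t e => simp [leftAdd_single, rightAdd_single, single_mul_single, mul_assoc]

theorem star_leftAdd (g : G) (f : CovAlg α) : star (leftAdd α g f) = rightAdd α g⁻¹ (star f) := by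
  induction f using CovAlg.induction with
  | h0 => simp
  | hadd f f' hf hf' => simp only [map_add, star_add, hf, hf']
  | hs s d =>
    simp only [leftAdd_single, rightAdd_single, star_single, mul_inv_rev, map_mul,
      StarAlgEquiv.mul_apply, ← map_star]
    rw [← StarAlgEquiv.mul_apply (α g⁻¹), ← map_mul]; simp

theorem leftAdd_leftAdd (g h : G) (f : CovAlg α) :
    leftAdd α g (leftAdd α h f) = leftAdd α (g * h) f := by
  induction f using CovAlg.induction with
  | h0 => simp
  | hadd f f' hf hf' => simp only [map_add, hf, hf']
  | hs s d => simp [leftAdd_single, mul_assoc]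

theorem rightAdd_rightAdd (g h : G) (f : CovAlg α) :
    rightAdd α h (rightAdd α g f) = rightAdd α (g * h) f := by
  induction f using CovAlg.induction with
  | h0 => simp
  | hadd f f' hf hf' => simp only [map_add, hf, hf']
  | hs s d => simp [rightAdd_single, mul_assoc]

theorem leftAdd_one (f : CovAlg α) : leftAdd α 1 f = f := by
  induction f using CovAlg.induction with
  | h0 => simp
  | hadd f f' hf hf' => simp only [map_add, hf, hf']
  | hs s d => simp [leftAdd_single]

theorem rightAdd_one (f : CovAlg α) : rightAdd α 1 f = f := by
  induction f using CovAlg.induction with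
  | h0 => simp
  | hadd f f' hf hf' => simp only [map_add, hf, hf']
  | hs s d => simp [rightAdd_single]

theorem leftAdd_smul (g : G) (c : ℂ) (f : CovAlg α) : leftAdd α g (c • f) = c • leftAdd α g f := by
  induction f using CovAlg.induction with
  | h0 => simp
  | hadd f f' hf hf' => simp only [map_add, smul_add, hf, hf']
  | hs s d => simp [leftAdd_single, smul_single]

theorem rightAdd_smul (g : G) (c : ℂ) (f : CovAlg α) :
    rightAdd α g (c • f) = c • rightAdd α g f := by
  induction f using CovAlg.induction with
  | h0 => simp
  | hadd f f' hf hf' => simp only [map_add, smul_add, hf, hf']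
  | hs s d => simp [rightAdd_single, smul_single]

theorem norm_leftAdd_le (g : G) (f : CovAlg α) : ‖leftAdd α g f‖ ≤ ‖f‖ := by
  have h : star (leftAdd α g f) * leftAdd α g f = star f * f := by
    rw [star_leftAdd, rightAdd_mul, leftAdd_leftAdd, inv_mul_cancel, leftAdd_one]
  have h1 := univNorm_sq_le (leftAdd α g f)
  have h2 : univNorm (star f * f) ≤ univNorm f * univNorm f := by
    simpa [univNorm_star] using univNorm_mul_le (star f) f
  rw [h] at h1
  exact le_of_not_gt fun hlt => absurd (h1.trans h2)
    (not_le.mpr (mul_self_lt_mul_self (univNorm_nonneg f) hlt))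

theorem norm_rightAdd_le (g : G) (f : CovAlg α) : ‖rightAdd α g f‖ ≤ ‖f‖ := by
  have h := norm_leftAdd_le g⁻¹ (star f)
  rw [← norm_star, star_leftAdd, star_star, inv_inv, norm_star] at h
  simpa using h

/-- Left multiplication by `g` as a bounded operator. -/
def leftL (g : G) : CovAlg α →L[ℂ] CovAlg α :=
  LinearMap.mkContinuous { leftAdd α g with map_smul' := leftAdd_smul g } 1
    fun f => by rw [one_mul]; exact norm_leftAdd_le g f

/-- Right multiplication by `g` as a bounded operator. -/
def rightL (g : G) : CovAlg α →L[ℂ] CovAlg α :=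
  LinearMap.mkContinuous { rightAdd α g with map_smul' := rightAdd_smul g } 1
    fun f => by rw [one_mul]; exact norm_rightAdd_le g f

end CovAlg

namespace CrossedProduct

open UniformSpace
open scoped MultiplierAlgebra

variable {G : Type*} {D : Type*} [Group G] [NonUnitalCStarAlgebra D] {α : G →* (D ≃⋆ₐ[ℂ] D)}

theorem isUniformInducing_of : IsUniformInducing (of : CovAlg α → CrossedProduct α) :=
  Completion.isUniformInducing_coe (CovAlg α)

/-- The continuous extension to `D ⋊_α G` of a bounded operator on `C_c(G, D)`. -/
def extend (T : CovAlg α →L[ℂ] CovAlg α) : CrossedProduct α →L[ℂ] CrossedProduct α :=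
  (of.comp T).extend of

@[simp] theorem extend_of (T : CovAlg α →L[ℂ] CovAlg α) (f : CovAlg α) :
    extend T (of f) = of (T f) :=
  ContinuousLinearMap.extend_eq _ denseRange_of isUniformInducing_of f

/-- The canonical homomorphism `i_G` of `G` into the multiplier algebra of `D ⋊_α G`. -/
def iG (α : G →* (D ≃⋆ₐ[ℂ] D)) : G →* 𝓜(ℂ, CrossedProduct α) where
  toFun g :=
    { toProd := (extend (CovAlg.leftL g), extend (CovAlg.rightL g))
      central := fun x y => by
        refine induction₂ x y ?_ fun f k => ?_
        · exact isClosed_eq (by fun_prop) (by fun_prop)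
        · simp only [extend_of, ← of_mul]
          exact congrArg of (CovAlg.rightAdd_mul g f k) }
  map_one' := by
    refine DoubleCentralizer.ext _ _ _ _ (Prod.ext ?_ ?_)
    · ext x
      refine induction₁ x ?_ fun f => ?_
      · exact isClosed_eq (by fun_prop) (by fun_prop)
      · exact (extend_of _ f).trans (congrArg of (CovAlg.leftAdd_one f))
    · ext x
      refine induction₁ x ?_ fun f => ?_
      · exact isClosed_eq (by fun_prop) (by fun_prop)
      · exact (extend_of _ f).trans (congrArg of (CovAlg.rightAdd_one f))
  map_mul' g h := by
    refine DoubleCentralizer.ext _ _ _ _ (Prod.ext ?_ ?_)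
    · ext x
      change extend (CovAlg.leftL (g * h)) x =
        extend (CovAlg.leftL g) (extend (CovAlg.leftL h) x)
      refine induction₁ x ?_ fun f => ?_
      · exact isClosed_eq (by fun_prop) (by fun_prop)
      · simp only [extend_of]
        exact congrArg of (CovAlg.leftAdd_leftAdd g h f).symm
    · ext x
      change extend (CovAlg.rightL (g * h)) x =
        extend (CovAlg.rightL h) (extend (CovAlg.rightL g) x)
      refine induction₁ x ?_ fun f => ?_
      · exact isClosed_eq (by fun_prop) (by fun_prop)
      · simp only [extend_of]
        exact congrArg of (CovAlg.rightAdd_rightAdd g h f).symm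

theorem iG_fst_of (g : G) (f : CovAlg α) : (iG α g).fst (of f) = of (CovAlg.leftAdd α g f) :=
  extend_of _ f

theorem iG_snd_of (g : G) (f : CovAlg α) : (iG α g).snd (of f) = of (CovAlg.rightAdd α g f) :=
  extend_of _ f

end CrossedProduct

/-! ### Corners -/

/-- The corner `pAp` of a C⋆-algebra `A` at a projection `p`. -/
def Corner {A : Type*} [NonUnitalCStarAlgebra A] (p : A) (hp : IsStarProjection p) :
    NonUnitalStarSubalgebra ℂ A where
  carrier := {x | p * x = x ∧ x * p = x}
  add_mem' hx hy := ⟨by rw [mul_add, hx.1, hy.1], by rw [add_mul, hx.2, hy.2]⟩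
  zero_mem' := ⟨mul_zero p, zero_mul p⟩
  mul_mem' hx hy := ⟨by rw [← mul_assoc, hx.1], by rw [mul_assoc, hy.2]⟩
  smul_mem' c x hx := ⟨by rw [mul_smul_comm, hx.1], by rw [smul_mul_assoc, hx.2]⟩
  star_mem' {x} hx := by
    have hs : star p = p := hp.isSelfAdjoint
    constructor
    · have := congrArg star hx.2
      rwa [star_mul, hs] at this
    · have := congrArg star hx.1
      rwa [star_mul, hs] at this

namespace Corner

open scoped MultiplierAlgebra

variable {A : Type*} [NonUnitalCStarAlgebra A] {p : A} {hp : IsStarProjection p}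

instance isClosed : IsClosed (Corner p hp : Set A) :=
  (isClosed_eq (continuous_const.mul continuous_id) continuous_id).inter
    (isClosed_eq (continuous_id.mul continuous_const) continuous_id)

/-- The corner `pAp` is a unital C⋆-algebra with unit `p`. -/
instance : CStarAlgebra (Corner p hp) :=
  let _ : Ring (Corner p hp) :=
    { (inferInstance : NonUnitalRing (Corner p hp)) with
      one := ⟨p, hp.isIdempotentElem, hp.isIdempotentElem⟩
      one_mul := fun x => Subtype.ext x.2.1
      mul_one := fun x => Subtype.ext x.2.2 }
  { (NonUnitalStarSubalgebra.nonUnitalCStarAlgebra (Corner p hp) :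
      NonUnitalCStarAlgebra (Corner p hp)),
    Algebra.ofModule (R := ℂ) (A := Corner p hp) smul_mul_assoc mul_smul_comm with
    one := ⟨p, hp.isIdempotentElem, hp.isIdempotentElem⟩
    one_mul := fun x => Subtype.ext x.2.1
    mul_one := fun x => Subtype.ext x.2.2
    norm_smul_le := norm_smul_le }

/-- The compression `p z p ∈ pAp` of a multiplier `z` of `A`. -/
def compress (p : A) (hp : IsStarProjection p) (z : 𝓜(ℂ, A)) : Corner p hp :=
  ⟨p * z.fst p * p, by
    have h : p * p = p := hp.isIdempotentElem
    constructor
    · rw [← mul_assoc, ← mul_assoc, h]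
    · rw [mul_assoc, h]⟩

theorem fst_mul (z : 𝓜(ℂ, A)) (x y : A) : z.fst (x * y) = z.fst x * y := by
  have h : ∀ w : A, w * (z.fst (x * y) - z.fst x * y) = 0 := fun w => by
    rw [mul_sub, ← mul_assoc, ← z.central, ← z.central, mul_assoc, sub_self]
  exact sub_eq_zero.mp ((CStarRing.star_mul_self_eq_zero_iff _).mp (h _))

theorem coe_compress (z : 𝓜(ℂ, A)) :
    ((compress p hp z : A) : 𝓜(ℂ, A)) = (p : 𝓜(ℂ, A)) * z * (p : 𝓜(ℂ, A)) := by
  refine DoubleCentralizer.ext _ _ _ _ (Prod.ext ?_ ?_)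
  · ext x
    change p * z.fst p * p * x = p * z.fst (p * x)
    have h : p * p = p := hp.isIdempotentElem
    rw [fst_mul, mul_assoc p, ← fst_mul, h, mul_assoc]
  · ext x
    change x * (p * z.fst p * p) = z.snd (x * p) * p
    have h : p * p = p := hp.isIdempotentElem
    rw [z.central, mul_assoc p, ← fst_mul, h, mul_assoc]

end Corner

/-! ### The semidirect product, its action on `N` and the associated algebras -/

open scoped ENNReal

section LInfty

variable (N : Type*)

/-- The C⋆-algebra `ℓ^∞(N)` of bounded complex functions on `N`. -/
abbrev LInfty : Type _ := lp (fun _ : N => ℂ) ∞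

variable {N}

/-- The characteristic function of a set. -/
def chi (s : Set N) : LInfty N :=
  ⟨s.indicator 1, memℓp_infty ⟨1, by
    rintro _ ⟨n, rfl⟩
    by_cases h : n ∈ s <;> simp [h]⟩⟩

/-- Composition with a permutation of `N`. -/
def compPerm (σ : Equiv.Perm N) (f : LInfty N) : LInfty N :=
  ⟨fun n => f (σ n), memℓp_infty ⟨‖f‖, by
    rintro _ ⟨n, rfl⟩
    exact lp.norm_apply_le_norm ENNReal.top_ne_zero f (σ n)⟩⟩

@[simp] theorem compPerm_apply (σ : Equiv.Perm N) (f : LInfty N) (n : N) :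
    compPerm σ f n = f (σ n) := rfl

/-- Permutations of `N` act on `ℓ^∞(N)` by `f ↦ f ∘ σ⁻¹`. -/
def permAction : Equiv.Perm N →* (LInfty N ≃⋆ₐ[ℂ] LInfty N) where
  toFun σ :=
    { toFun := compPerm σ⁻¹
      invFun := compPerm σ
      left_inv := fun f => by ext n; simp
      right_inv := fun f => by ext n; simp
      map_mul' := fun f g => rfl
      map_add' := fun f g => rfl
      map_star' := fun f => rfl
      map_smul' := fun c f => rfl }
  map_one' := by ext f n; rfl
  map_mul' σ τ := by ext f n; simp; rfl

@[simp] theorem permAction_apply (σ : Equiv.Perm N) (f : LInfty N) (n : N) :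
    permAction σ f n = f (σ⁻¹ n) := rfl

end LInfty

section Semidirect

variable {N H : Type*} [Group N] [Group H]

/-- The subgroup `aMa⁻¹` of `N`, for `a ∈ H`. -/
def conjSubgroup (φ : H →* MulAut N) (M : Subgroup N) (a : H) : Subgroup N :=
  M.map (φ a).toMonoidHom

/-- The family `𝒰` of the conjugates `aMa⁻¹`, `a ∈ H`. -/
def conjFamily (φ : H →* MulAut N) (M : Subgroup N) : Set (Subgroup N) :=
  Set.range (conjSubgroup φ M)

/-- The semigroup `H⁺` of all `a ∈ H` with `aMa⁻¹ ⊆ M`. -/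
def HPlus (φ : H →* MulAut N) (M : Subgroup N) : Submonoid H where
  carrier := {a | conjSubgroup φ M a ≤ M}
  one_mem' := by
    rintro _ ⟨n, hn, rfl⟩
    simpa using hn
  mul_mem' {a b} ha hb := by
    rintro _ ⟨n, hn, rfl⟩
    have := ha ⟨_, hb ⟨n, hn, rfl⟩, rfl⟩
    simpa using this

/-- The endomorphism `m ↦ ama⁻¹` of `M`, for `a ∈ H⁺`. -/
def conjHom (φ : H →* MulAut N) (M : Subgroup N) (a : HPlus φ M) : M →* M :=
  ((φ a).toMonoidHom.comp M.subtype).codRestrict M fun m => a.2 ⟨m, m.2, rfl⟩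

/-- The action `β` of `G = N ⋊ H` on `N`: `β_{xa}(y) = x a y a⁻¹`. -/
def beta (φ : H →* MulAut N) : N ⋊[φ] H →* Equiv.Perm N where
  toFun g := (φ g.right).toEquiv.trans (Equiv.mulLeft g.left)
  map_one' := by ext y; simp
  map_mul' g h := by ext y; simp

theorem beta_apply (φ : H →* MulAut N) (g : N ⋊[φ] H) (y : N) :
    beta φ g y = g.left * φ g.right y := rfl

/-- The set `𝒫` of the characteristic functions `χ_{xU}`, `x ∈ N`, `U ∈ 𝒰`. -/
def cosetProjections (φ : H →* MulAut N) (M : Subgroup N) : Set (LInfty N) :=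
  {f | ∃ x : N, ∃ U ∈ conjFamily φ M, f = chi ((fun y => x * y) '' (U : Set N))}

/-- The C⋆-subalgebra `D = C⋆(𝒫)` of `ℓ^∞(N)`. -/
def algD (φ : H →* MulAut N) (M : Subgroup N) : NonUnitalStarSubalgebra ℂ (LInfty N) :=
  (NonUnitalStarAlgebra.adjoin ℂ (cosetProjections φ M)).topologicalClosure

instance isClosed_algD (φ : H →* MulAut N) (M : Subgroup N) :
    IsClosed (algD φ M : Set (LInfty N)) :=
  NonUnitalStarSubalgebra.isClosed_topologicalClosure _

theorem permAction_chi (σ : Equiv.Perm N) (s : Set N) : permAction σ (chi s) = chi (σ '' s) := by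
  ext n
  change s.indicator 1 (σ⁻¹ n) = (σ '' s).indicator 1 n
  rw [Equiv.image_eq_preimage_symm]
  rfl

theorem permAction_mem (φ : H →* MulAut N) (M : Subgroup N) (g : N ⋊[φ] H) {f : LInfty N}
    (hf : f ∈ algD φ M) : permAction (beta φ g) f ∈ algD φ M := by
  let T : LInfty N →⋆ₙₐ[ℂ] LInfty N := (permAction (beta φ g) : LInfty N →⋆ₙₐ[ℂ] LInfty N)
  have hT : Continuous T := by
    refine AddMonoidHomClass.continuous_of_bound T 1 fun f => ?_
    rw [one_mul]
    refine lp.norm_le_of_forall_le (norm_nonneg f) fun n => ?_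
    exact lp.norm_apply_le_norm ENNReal.top_ne_zero f _
  have key : algD φ M ≤ (algD φ M).comap T := by
    refine NonUnitalStarSubalgebra.topologicalClosure_minimal _ ?_
      ((isClosed_algD φ M).preimage hT)
    refine NonUnitalStarAlgebra.adjoin_le ?_
    rintro _ ⟨x, _, ⟨a, rfl⟩, rfl⟩
    refine NonUnitalStarSubalgebra.le_topologicalClosure _
      (NonUnitalStarAlgebra.subset_adjoin ℂ _
        ⟨beta φ g x, conjSubgroup φ M (g.right * a), ⟨_, rfl⟩, ?_⟩)
    change permAction (beta φ g) (chi _) = _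
    rw [permAction_chi]
    congr 1
    rw [Set.image_image]
    ext y
    simp only [conjSubgroup, beta_apply, Set.mem_image, SetLike.mem_coe, Subgroup.mem_map]
    simp [mul_assoc]
  exact key hf

/-- The C⋆-algebra `D`, as a type. -/
def AlgD (φ : H →* MulAut N) (M : Subgroup N) : Type _ := algD φ M

instance (φ : H →* MulAut N) (M : Subgroup N) : NonUnitalCStarAlgebra (AlgD φ M) :=
  NonUnitalStarSubalgebra.nonUnitalCStarAlgebra (algD φ M)

/-- The inclusion `D ⊆ ℓ^∞(N)`. -/
def AlgD.incl (φ : H →* MulAut N) (M : Subgroup N) : AlgD φ M →⋆ₙₐ[ℂ] LInfty N where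
  toFun f := f.1
  map_smul' _ _ := rfl
  map_zero' := rfl
  map_add' _ _ := rfl
  map_mul' _ _ := rfl
  map_star' _ := rfl

theorem AlgD.incl_injective (φ : H →* MulAut N) (M : Subgroup N) :
    Function.Injective (AlgD.incl φ M) := Subtype.val_injective

/-- The automorphism `α_g(f) = f ∘ β_{g⁻¹}` of `D`. -/
def alphaEquiv (φ : H →* MulAut N) (M : Subgroup N) (g : N ⋊[φ] H) :
    AlgD φ M ≃⋆ₐ[ℂ] AlgD φ M where
  toFun f := ⟨permAction (beta φ g) f.1, permAction_mem φ M g f.2⟩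
  invFun f := ⟨permAction (beta φ g⁻¹) f.1, permAction_mem φ M g⁻¹ f.2⟩
  left_inv f := Subtype.ext <| by
    change permAction (beta φ g⁻¹) (permAction (beta φ g) f.1) = f.1
    rw [← StarAlgEquiv.mul_apply, ← map_mul, ← map_mul]; simp
  right_inv f := Subtype.ext <| by
    change permAction (beta φ g) (permAction (beta φ g⁻¹) f.1) = f.1
    rw [← StarAlgEquiv.mul_apply, ← map_mul, ← map_mul]; simp
  map_mul' f k := Subtype.ext (map_mul (permAction (beta φ g)) f.1 k.1)
  map_add' f k := Subtype.ext (map_add (permAction (beta φ g)) f.1 k.1)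
  map_star' f := Subtype.ext (map_star (permAction (beta φ g)) f.1)
  map_smul' c f := Subtype.ext (map_smul (permAction (beta φ g)) c f.1)

theorem incl_alphaEquiv (φ : H →* MulAut N) (M : Subgroup N) (g : N ⋊[φ] H) (f : AlgD φ M) :
    AlgD.incl φ M (alphaEquiv φ M g f) = permAction (beta φ g) (AlgD.incl φ M f) := rfl

/-- The action `α` of `G = N ⋊ H` on `D`. -/
def alpha (φ : H →* MulAut N) (M : Subgroup N) : N ⋊[φ] H →* (AlgD φ M ≃⋆ₐ[ℂ] AlgD φ M) where
  toFun := alphaEquiv φ M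
  map_one' := StarAlgEquiv.ext fun f => AlgD.incl_injective φ M <| by
    rw [incl_alphaEquiv, map_one]; simp
  map_mul' g h := StarAlgEquiv.ext fun f => AlgD.incl_injective φ M <| by
    rw [StarAlgEquiv.mul_apply, incl_alphaEquiv, incl_alphaEquiv, incl_alphaEquiv,
      map_mul, map_mul, StarAlgEquiv.mul_apply]

theorem incl_alpha (φ : H →* MulAut N) (M : Subgroup N) (g : N ⋊[φ] H) (f : AlgD φ M) (y : N) :
    AlgD.incl φ M (alpha φ M g f) y = AlgD.incl φ M f (beta φ g⁻¹ y) := by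
  rw [map_inv]
  rfl

/-- The full crossed product `A = D ⋊_α G`. -/
abbrev algA (φ : H →* MulAut N) (M : Subgroup N) : Type _ := CrossedProduct (alpha φ M)

/-- The projection `χ_M ∈ D`. -/
def chiM (φ : H →* MulAut N) (M : Subgroup N) : AlgD φ M :=
  ⟨chi (M : Set N), NonUnitalStarSubalgebra.le_topologicalClosure _
    (NonUnitalStarAlgebra.subset_adjoin ℂ _
      ⟨1, conjSubgroup φ M 1, ⟨1, rfl⟩, by congr 1; ext y; simp [conjSubgroup]⟩)⟩

theorem isStarProjection_chiM (φ : H →* MulAut N) (M : Subgroup N) :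
    IsStarProjection (chiM φ M) where
  isIdempotentElem := AlgD.incl_injective φ M <| by
    ext n
    change (M : Set N).indicator (1 : N → ℂ) n * (M : Set N).indicator (1 : N → ℂ) n =
      (M : Set N).indicator 1 n
    by_cases h : n ∈ (M : Set N) <;> simp [h]
  isSelfAdjoint := AlgD.incl_injective φ M <| by
    ext n
    change star ((M : Set N).indicator (1 : N → ℂ) n) = (M : Set N).indicator 1 n
    by_cases h : n ∈ (M : Set N) <;> simp [h]

/-- The projection `p = χ_M`, as an element of `A`. -/
def projP (φ : H →* MulAut N) (M : Subgroup N) : algA φ M :=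
  CrossedProduct.iD (alpha φ M) (chiM φ M)

theorem isStarProjection_projP (φ : H →* MulAut N) (M : Subgroup N) :
    IsStarProjection (projP φ M) :=
  (isStarProjection_chiM φ M).map (CrossedProduct.iD (alpha φ M))

/-- The corner `pAp`. -/
abbrev cornerA (φ : H →* MulAut N) (M : Subgroup N) : NonUnitalStarSubalgebra ℂ (algA φ M) :=
  Corner (projP φ M) (isStarProjection_projP φ M)

/-- The element `s_a = pap` of `pAp`, for `a ∈ H⁺`. -/
def cornerS (φ : H →* MulAut N) (M : Subgroup N) (a : HPlus φ M) : cornerA φ M :=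
  Corner.compress _ _ (CrossedProduct.iG (alpha φ M) (SemidirectProduct.inr (a : H)))

/-- The element `u(m) = pmp` of `pAp`, for `m ∈ M`. -/
def cornerU (φ : H →* MulAut N) (M : Subgroup N) (m : M) : cornerA φ M :=
  Corner.compress _ _ (CrossedProduct.iG (alpha φ M) (SemidirectProduct.inl (m : N)))

/-- An SU-family in a unital C⋆-algebra `B`: isometries `S_a`, `a ∈ H⁺`, and unitaries `U(m)`,
`m ∈ M`, subject to the Cuntz-Li type relations. The sum in `sum_eq_one` runs over the cosets
`m aMa⁻¹` in `M / aMa⁻¹`; by the other relations its terms do not depend on the choice of the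
representatives `m`. -/
structure IsSUFamily (φ : H →* MulAut N) (M : Subgroup N) {B : Type*} [CStarAlgebra B]
    (S : HPlus φ M → B) (U : M → B) : Prop where
  isometry : ∀ a, star (S a) * S a = 1
  unitary : ∀ m, U m ∈ unitary B
  S_mul_S : ∀ a b, S a * S b = S (a * b)
  S_mul_U : ∀ a m, S a * U m = U (conjHom φ M a m) * S a
  sum_eq_one : ∀ a, ∑ᶠ c : M ⧸ (conjHom φ M a).range,
    U (Quotient.out c) * S a * star (S a) * U (Quotient.out c)⁻¹ = 1
  U_mul_U : ∀ m k, U m * U k = U (m * k)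

end Semidirect

end

/-! An SU-family should be thought of as a corner of a covariant representation of `(D, G)`: cut
down by `p = χ_M`, the group element `g` becomes a partial isometry `W_g` (`partialRep`), and `D` is
represented on the range of `p`. The proof rebuilds these compressed data from the relations.

Coefficients. The projections `P_e(m) = U(m) S_e S_e^* U(m)^*` depend only on the coset of `m`
modulo `eMe⁻¹`, sum to `1` and are therefore orthogonal. A function constant on the cosets of
`eMe⁻¹` acts through them by its values on `M`, consistently when `e` is replaced by a multiple.
Such functions are dense in `D`, so the limit over `e` is a representation `rep` of `D` with `χ_M ↦
1`.

Group. Every `g` in `G` is a fraction `b⁻¹mc`, and `W_g = S_b^* U(m) S_c` does not depend on the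
fraction, because `H` is abelian and common factors cancel by `S_e^* S_e = 1`. Then `W_g rep(d) =
rep(α_g d) W_g` and `W_g W_k = rep(α_g χ_M) W_{gk}`, so that `covRep : d·g ↦ rep(d) W_g` satisfies
`covRep (f p k) = covRep f * covRep k`.

Norm. The main difficulty is that `covRep` plays the role of the compression `f ↦ pfp` and need not
be multiplicative, so its bound by the universal norm is not automatic. Instead of dilating to a
larger space, consider `f ↦ covRep (b f b⁻¹)`, the compression to `χ_{b⁻¹Mb}`. These projections
form an approximate unit of `D`. The norms increase with `b` and the maps are asymptotically
multiplicative, so the supremum of the norms is a C⋆-seminorm below the `ℓ¹`-norm, hence below the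
universal norm (`cstarSeminorm`, `norm_covRep_le`). Thus `covRep` extends to `A`, and it is
multiplicative on `pAp`, where the inserted `p` disappears.

Generation and uniqueness. In `pAp` the map `g ↦ pgp` is multiplicative whenever the right factor
carries `M` into `M`; this gives the relations and puts every `pgp` into the generated algebra. The
elements `pχ_{xU}` are finite combinations of the `P_e(m)`, and `p(dg)p = (pdp)(pgp)` because `D` is
commutative. -/

noncomputable section

open Filter Topology

/-! ### Projections with sum one -/

section CStarLemmas

/-- Compressing `∑ p k = 1` by `p j` gives `∑ p j * p k * p j = p j`, whose term `k = j` is already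
`p j`. The remaining terms are the positive elements `(p k * p j)^* (p k * p j)`; their sum is zero,
so each vanishes. -/
theorem isStarProjection_mul_eq_zero_of_sum_eq_one {B ι : Type*} [CStarAlgebra B] [Fintype ι]
    {p : ι → B} (hp : ∀ i, IsStarProjection (p i)) (hsum : ∑ i, p i = 1) {i j : ι} (hij : i ≠ j) :
    p i * p j = 0 := by
  classical
  let _ := CStarAlgebra.spectralOrder B
  let _ := CStarAlgebra.spectralOrderedRing B
  have key : ∑ k ∈ Finset.univ.erase j, star (p k * p j) * (p k * p j) = 0 := by
    have h1 : ∀ k, star (p k * p j) * (p k * p j) = p j * p k * p j := fun k => by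
      rw [star_mul, (hp k).isSelfAdjoint.star_eq, (hp j).isSelfAdjoint.star_eq, mul_assoc,
        ← mul_assoc (p k), (hp k).isIdempotentElem.eq, mul_assoc]
    have h2 : ∑ k, p j * p k * p j = p j := by
      rw [← Finset.sum_mul, ← Finset.mul_sum, hsum, mul_one, (hp j).isIdempotentElem.eq]
    rw [← Finset.add_sum_erase _ _ (Finset.mem_univ j), (hp j).isIdempotentElem.eq,
      (hp j).isIdempotentElem.eq, add_eq_left] at h2
    simpa only [h1] using h2
  rw [Finset.sum_eq_zero_iff_of_nonneg fun k _ => star_mul_self_nonneg _] at key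
  exact (CStarRing.star_mul_self_eq_zero_iff _).mp (key i (by simp [hij]))

end CStarLemmas

/-! ### The semigroup `H⁺` and its divisibility order -/

section HPlus

variable {N H : Type*} [Group N] [CommGroup H] {φ : H →* MulAut N} {M : Subgroup N}

theorem mem_conjSubgroup {N H : Type*} [Group N] [Group H] {φ : H →* MulAut N} {M : Subgroup N}
    {a : H} {n : N} : n ∈ conjSubgroup φ M a ↔ φ a⁻¹ n ∈ M := by
  constructor
  · rintro ⟨m, hm, rfl⟩
    simpa using hm
  · intro h
    exact ⟨_, h, by simp⟩

theorem mem_HPlus {N H : Type*} [Group N] [Group H] {φ : H →* MulAut N} {M : Subgroup N} {a : H} :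
    a ∈ HPlus φ M ↔ ∀ m ∈ M, φ a m ∈ M :=
  ⟨fun h m hm => h ⟨m, hm, rfl⟩, by rintro h _ ⟨m, hm, rfl⟩; exact h m hm⟩

/-- On `H⁺` this translates divisibility into reverse inclusion of the subgroups `aMa⁻¹`, so going
up in the preorder below refines the cosets. -/
theorem inv_mul_mem_HPlus {N H : Type*} [Group N] [Group H] {φ : H →* MulAut N} {M : Subgroup N}
    {a b : H} : a⁻¹ * b ∈ HPlus φ M ↔ conjSubgroup φ M b ≤ conjSubgroup φ M a := by
  rw [mem_HPlus]
  constructor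
  · rintro h _ ⟨m, hm, rfl⟩
    have := h m hm
    rw [mem_conjSubgroup]
    simpa using this
  · intro h m hm
    have := h ⟨m, hm, rfl⟩
    rw [mem_conjSubgroup] at this
    simpa using this

/-- `H⁺` is preordered by divisibility. -/
instance : Preorder (HPlus φ M) where
  le a b := a ∣ b
  le_refl := dvd_refl
  le_trans _ _ _ := dvd_trans

instance : IsDirectedOrder (HPlus φ M) where
  directed a b := ⟨a * b, dvd_mul_right a b, dvd_mul_left b a⟩

instance : Nonempty (HPlus φ M) := ⟨1⟩

@[simp] theorem coe_conjHom (a : HPlus φ M) (m : M) : (conjHom φ M a m : N) = φ a m := rfl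

theorem mem_range_conjHom {a : HPlus φ M} {m : M} :
    m ∈ (conjHom φ M a).range ↔ (m : N) ∈ conjSubgroup φ M a := by
  constructor
  · rintro ⟨k, rfl⟩
    exact ⟨k, k.2, rfl⟩
  · rintro ⟨k, hk, h⟩
    exact ⟨⟨k, hk⟩, Subtype.ext h⟩

/-- Constancy of a function on the cosets `n · aMa⁻¹`. -/
def CosetInvariant (φ : H →* MulAut N) (M : Subgroup N) (a : H) (f : N → ℂ) : Prop :=
  ∀ n, ∀ k ∈ conjSubgroup φ M a, f (n * k) = f n

theorem CosetInvariant.eq {e : HPlus φ M} {f : N → ℂ} (hf : CosetInvariant φ M e f) {m k : M}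
    (h : m⁻¹ * k ∈ (conjHom φ M e).range) : f k = f m := by
  have := hf m _ (mem_range_conjHom.mp h)
  simpa using this

theorem CosetInvariant.mono {a b : H} {f : N → ℂ} (hf : CosetInvariant φ M a f)
    (h : conjSubgroup φ M b ≤ conjSubgroup φ M a) : CosetInvariant φ M b f :=
  fun n k hk => hf n k (h hk)

/-- The conditions on `H`, `N` and `M` in terms of the semigroup `H⁺`: `H = H⁺ (H⁺)⁻¹`,
the groups `a⁻¹Ma`, `a ∈ H⁺`, exhaust `N`, and `aMa⁻¹` has finite index in `M` for `a ∈ H⁺`. -/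
class IsExhausting (φ : H →* MulAut N) (M : Subgroup N) : Prop where
  exists_inv_mul_mem : ∀ a : H, ∃ e : HPlus φ M, a⁻¹ * e ∈ HPlus φ M
  exists_map_mem : ∀ n : N, ∃ a : HPlus φ M, φ a n ∈ M
  finite_quotient : ∀ a : HPlus φ M, Finite (M ⧸ (conjHom φ M a).range)

end HPlus

/-! ### Range projections of an SU-family and step functions -/

namespace IsSUFamily

variable {N H : Type*} [Group N] [CommGroup H] {φ : H →* MulAut N} {M : Subgroup N}
  {B : Type*} [CStarAlgebra B] {S : HPlus φ M → B} {U : M → B}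

theorem U_one (h : IsSUFamily φ M S U) : U 1 = 1 := by
  have h1 : U 1 * U 1 = U 1 := by rw [h.U_mul_U, one_mul]
  calc U 1 = star (U 1) * U 1 * U 1 := by rw [Unitary.star_mul_self_of_mem (h.unitary 1), one_mul]
    _ = 1 := by rw [mul_assoc, h1, Unitary.star_mul_self_of_mem (h.unitary 1)]

theorem S_one (h : IsSUFamily φ M S U) : S 1 = 1 := by
  have h1 : S 1 * S 1 = S 1 := by rw [h.S_mul_S, one_mul]
  calc S 1 = star (S 1) * S 1 * S 1 := by rw [h.isometry, one_mul]
    _ = 1 := by rw [mul_assoc, h1, h.isometry]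

theorem U_mul_inv (h : IsSUFamily φ M S U) (m : M) : U m * U m⁻¹ = 1 := by
  rw [h.U_mul_U, mul_inv_cancel, h.U_one]

theorem star_U (h : IsSUFamily φ M S U) (m : M) : star (U m) = U m⁻¹ := by
  calc star (U m) = star (U m) * (U m * U m⁻¹) := by rw [h.U_mul_inv, mul_one]
    _ = U m⁻¹ := by rw [← mul_assoc, Unitary.star_mul_self_of_mem (h.unitary m), one_mul]

/-- The range projection of the isometry `U m * S e`. -/
def rangeProj (_h : IsSUFamily φ M S U) (e : HPlus φ M) (m : M) : B :=
  U m * S e * star (S e) * U m⁻¹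

theorem rangeProj_eq (h : IsSUFamily φ M S U) (e : HPlus φ M) (m : M) :
    h.rangeProj e m = U m * S e * star (U m * S e) := by
  rw [rangeProj, star_mul, h.star_U, mul_assoc]

theorem isometry_U_mul_S (h : IsSUFamily φ M S U) (e : HPlus φ M) (m : M) :
    star (U m * S e) * (U m * S e) = 1 := by
  rw [star_mul, mul_assoc, ← mul_assoc _ (U m), Unitary.star_mul_self_of_mem (h.unitary m), one_mul,
    h.isometry]

theorem isStarProjection_rangeProj (h : IsSUFamily φ M S U) (e : HPlus φ M) (m : M) :
    IsStarProjection (h.rangeProj e m) where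
  isIdempotentElem := by
    rw [IsIdempotentElem, rangeProj_eq, mul_assoc, ← mul_assoc _ (U m * S e), h.isometry_U_mul_S,
      one_mul]
  isSelfAdjoint := by
    rw [rangeProj_eq]
    exact .mul_star_self _

theorem rangeProj_mul_U_mul_S (h : IsSUFamily φ M S U) (e : HPlus φ M) (m : M) :
    h.rangeProj e m * (U m * S e) = U m * S e := by
  rw [rangeProj_eq, mul_assoc, h.isometry_U_mul_S, mul_one]

/-- The factor `eke⁻¹` passes through `S e` and multiplies the isometry `U m * S e` by the unitary
`U k` on the right, which leaves the range unchanged. -/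
theorem rangeProj_mul_conjHom (h : IsSUFamily φ M S U) (e : HPlus φ M) (m k : M) :
    h.rangeProj e (m * conjHom φ M e k) = h.rangeProj e m := by
  have h1 : U (m * conjHom φ M e k) * S e = U m * S e * U k := by
    rw [← h.U_mul_U, mul_assoc, ← h.S_mul_U, mul_assoc]
  rw [rangeProj_eq, rangeProj_eq, h1, star_mul, h.star_U, mul_assoc, ← mul_assoc (U k),
    h.U_mul_inv, one_mul]

theorem rangeProj_eq_of_mem (h : IsSUFamily φ M S U) {e : HPlus φ M} {m k : M}
    (hmk : m⁻¹ * k ∈ (conjHom φ M e).range) : h.rangeProj e k = h.rangeProj e m := by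
  obtain ⟨l, hl⟩ := hmk
  rw [← h.rangeProj_mul_conjHom e m l, hl, mul_inv_cancel_left]

theorem rangeProj_out (h : IsSUFamily φ M S U) (e : HPlus φ M) (m : M) :
    h.rangeProj e (Quotient.out (m : M ⧸ (conjHom φ M e).range)) = h.rangeProj e m :=
  h.rangeProj_eq_of_mem <| QuotientGroup.eq.mp (QuotientGroup.out_eq' _).symm

/-- Since `S (e * d) = S e * S d`, the range of `U k * S (e * d)` lies in that of `U k * S e`. -/
theorem rangeProj_mul_rangeProj_mul (h : IsSUFamily φ M S U) (e d : HPlus φ M) (k : M) :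
    h.rangeProj e k * h.rangeProj (e * d) k = h.rangeProj (e * d) k := by
  have h1 : U k * S (e * d) = U k * S e * S d := by rw [mul_assoc, h.S_mul_S]
  rw [rangeProj_eq h (e * d), h1, ← mul_assoc, ← mul_assoc _ _ (S d), rangeProj_mul_U_mul_S]

section Finite

variable [IsExhausting φ M]

/-- The coset spaces `M / eMe⁻¹` as finite types. -/
instance (a : HPlus φ M) : Fintype (M ⧸ (conjHom φ M a).range) :=
  have := IsExhausting.finite_quotient a
  Fintype.ofFinite _

theorem sum_rangeProj (h : IsSUFamily φ M S U) (e : HPlus φ M) :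
    ∑ c : M ⧸ (conjHom φ M e).range, h.rangeProj e (Quotient.out c) = 1 := by
  rw [← h.sum_eq_one e, finsum_eq_sum_of_fintype]
  rfl

theorem rangeProj_out_mul_of_ne (h : IsSUFamily φ M S U) (e : HPlus φ M)
    {c d : M ⧸ (conjHom φ M e).range} (hcd : c ≠ d) :
    h.rangeProj e (Quotient.out c) * h.rangeProj e (Quotient.out d) = 0 :=
  isStarProjection_mul_eq_zero_of_sum_eq_one
    (p := fun c : M ⧸ (conjHom φ M e).range => h.rangeProj e (Quotient.out c))
    (fun _ => h.isStarProjection_rangeProj e _) (h.sum_rangeProj e) hcd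

theorem rangeProj_mul_of_notMem (h : IsSUFamily φ M S U) {e : HPlus φ M} {m k : M}
    (hmk : m⁻¹ * k ∉ (conjHom φ M e).range) : h.rangeProj e m * h.rangeProj e k = 0 := by
  rw [← h.rangeProj_out e m, ← h.rangeProj_out e k]
  exact h.rangeProj_out_mul_of_ne e fun hc => hmk (QuotientGroup.eq.mp hc)

/-- The main device for identities in `B`: at a fine enough level `e`, elements coming from `D` act
on each range projection by a scalar. -/
theorem ext_rangeProj (h : IsSUFamily φ M S U) (e : HPlus φ M) {T T' : B}
    (hT : ∀ m, T * h.rangeProj e m = T' * h.rangeProj e m) : T = T' := by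
  rw [← mul_one T, ← mul_one T', ← h.sum_rangeProj e, Finset.mul_sum, Finset.mul_sum]
  exact Finset.sum_congr rfl fun c _ => hT _

/-- The representation `f ↦ ∑ f(m) U(m) S_e S_e^* U(m)^*` of `ℓ^∞(N)`, where `m` runs over
representatives of the cosets of `eMe⁻¹` in `M`. -/
def stepRep (h : IsSUFamily φ M S U) (e : HPlus φ M) : LInfty N →⋆ₙₐ[ℂ] B where
  toFun f := ∑ c : M ⧸ (conjHom φ M e).range,
    f (Quotient.out c : M) • h.rangeProj e (Quotient.out c)
  map_smul' r f := by
    rw [Finset.smul_sum]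
    refine Finset.sum_congr rfl fun c _ => ?_
    rw [smul_smul]; rfl
  map_zero' := Finset.sum_eq_zero fun c _ => zero_smul _ _
  map_add' f g := by
    rw [← Finset.sum_add_distrib]
    refine Finset.sum_congr rfl fun c _ => ?_
    rw [← add_smul]; rfl
  map_mul' f g := by
    rw [Finset.sum_mul]
    refine Finset.sum_congr rfl fun c _ => ?_
    rw [Finset.mul_sum, Finset.sum_eq_single c]
    · rw [smul_mul_smul_comm, (h.isStarProjection_rangeProj e _).isIdempotentElem.eq]
      rfl
    · intro d _ hd
      rw [smul_mul_smul_comm, h.rangeProj_out_mul_of_ne e hd.symm, smul_zero]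
    · simp
  map_star' f := by
    rw [star_sum]
    refine Finset.sum_congr rfl fun c _ => ?_
    rw [star_smul, (h.isStarProjection_rangeProj e _).isSelfAdjoint.star_eq]
    rfl

theorem stepRep_apply (h : IsSUFamily φ M S U) (e : HPlus φ M) (f : LInfty N) :
    h.stepRep e f = ∑ c : M ⧸ (conjHom φ M e).range,
      f (Quotient.out c : M) • h.rangeProj e (Quotient.out c) := rfl

theorem stepRep_mul_rangeProj (h : IsSUFamily φ M S U) {e : HPlus φ M} {f : LInfty N}
    (hf : CosetInvariant φ M e f) (m : M) :
    h.stepRep e f * h.rangeProj e m = f (m : N) • h.rangeProj e m := by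
  rw [stepRep_apply, Finset.sum_mul, Finset.sum_eq_single (m : M ⧸ (conjHom φ M e).range)]
  · rw [h.rangeProj_out, smul_mul_assoc, (h.isStarProjection_rangeProj e _).isIdempotentElem.eq]
    congr 1
    exact hf.eq (QuotientGroup.eq.mp (QuotientGroup.out_eq' _).symm)
  · intro d _ hd
    rw [← h.rangeProj_out e m, smul_mul_assoc, h.rangeProj_out_mul_of_ne e hd, smul_zero]
  · simp

/-- Both sides act on the finer projection at `m` by the scalar `f m`, because that projection lies
below the coarser one at `m`. -/
theorem stepRep_mul (h : IsSUFamily φ M S U) {e : HPlus φ M} {f : LInfty N}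
    (hf : CosetInvariant φ M e f) (d : HPlus φ M) : h.stepRep (e * d) f = h.stepRep e f := by
  have hf' : CosetInvariant φ M ((e * d : HPlus φ M) : H) f := hf.mono <| by
    rw [← inv_mul_mem_HPlus]
    simp
  refine h.ext_rangeProj (e * d) fun m => ?_
  rw [h.stepRep_mul_rangeProj hf', ← h.rangeProj_mul_rangeProj_mul, ← mul_assoc,
    h.stepRep_mul_rangeProj hf, smul_mul_assoc]

theorem stepRep_eq_of_le (h : IsSUFamily φ M S U) {e e' : HPlus φ M} {f : LInfty N}
    (hf : CosetInvariant φ M e f) (he : e ≤ e') : h.stepRep e' f = h.stepRep e f := by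
  obtain ⟨d, rfl⟩ := he
  exact h.stepRep_mul hf d

end Finite

end IsSUFamily

/-! ### The generators of `D` -/

section AlgD

variable {N H : Type*} [Group N] [Group H] {φ : H →* MulAut N} {M : Subgroup N}

/-- The projection `χ_{xaMa⁻¹}`, as an element of `D`. -/
def cosetChi (φ : H →* MulAut N) (M : Subgroup N) (x : N) (a : H) : AlgD φ M :=
  ⟨chi ((fun y => x * y) '' (conjSubgroup φ M a : Set N)),
    NonUnitalStarSubalgebra.le_topologicalClosure _
      (NonUnitalStarAlgebra.subset_adjoin ℂ _ ⟨x, _, ⟨a, rfl⟩, rfl⟩)⟩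

open Classical in
theorem incl_cosetChi (x : N) (a : H) (y : N) :
    AlgD.incl φ M (cosetChi φ M x a) y = if x⁻¹ * y ∈ conjSubgroup φ M a then 1 else 0 := by
  change Set.indicator _ (1 : N → ℂ) y = _
  rw [Set.indicator_apply]
  congr 1
  simp

theorem AlgD.ext {d e : AlgD φ M} (h : ∀ y, AlgD.incl φ M d y = AlgD.incl φ M e y) : d = e :=
  AlgD.incl_injective φ M (lp.ext (funext h))

theorem AlgD.mul_comm (d e : AlgD φ M) : d * e = e * d :=
  AlgD.ext fun y => by
    rw [map_mul, map_mul]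
    exact _root_.mul_comm (AlgD.incl φ M d y) (AlgD.incl φ M e y)

theorem beta_mem_iff (g : N ⋊[φ] H) (x y : N) (a : H) :
    x⁻¹ * beta φ g⁻¹ y ∈ conjSubgroup φ M a ↔
      (beta φ g x)⁻¹ * y ∈ conjSubgroup φ M (g.right * a) := by
  rw [beta_apply, beta_apply]
  simp [mem_conjSubgroup, mul_assoc]

theorem alpha_cosetChi (g : N ⋊[φ] H) (x : N) (a : H) :
    alpha φ M g (cosetChi φ M x a) = cosetChi φ M (beta φ g x) (g.right * a) := by
  classical
  refine AlgD.ext fun y => ?_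
  rw [incl_alpha, incl_cosetChi, incl_cosetChi]
  simp only [beta_mem_iff]

theorem chiM_eq_cosetChi : chiM φ M = cosetChi φ M 1 1 := by
  refine AlgD.incl_injective φ M ?_
  change chi _ = chi _
  congr 1
  ext y
  simp [conjSubgroup]

theorem alpha_chiM (g : N ⋊[φ] H) : alpha φ M g (chiM φ M) = cosetChi φ M g.left g.right := by
  rw [chiM_eq_cosetChi, alpha_cosetChi, beta_apply]
  simp

theorem star_cosetChi (x : N) (a : H) : star (cosetChi φ M x a) = cosetChi φ M x a := by
  classical
  refine AlgD.ext fun y => ?_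
  rw [map_star]
  change star (AlgD.incl φ M (cosetChi φ M x a) y) = _
  rw [incl_cosetChi]
  split_ifs <;> simp

@[elab_as_elim]
theorem AlgD.induction {P : AlgD φ M → Prop} (d : AlgD φ M) (hc : IsClosed {d | P d})
    (hgen : ∀ x a, P (cosetChi φ M x a)) (hzero : P 0) (hadd : ∀ d e, P d → P e → P (d + e))
    (hmul : ∀ d e, P d → P e → P (d * e)) (hsmul : ∀ (r : ℂ) d, P d → P (r • d))
    (hstar : ∀ d, P d → P (star d)) : P d := by
  have key : ∀ f (hf : f ∈ NonUnitalStarAlgebra.adjoin ℂ (cosetProjections φ M)),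
      P ⟨f, NonUnitalStarSubalgebra.le_topologicalClosure _ hf⟩ := by
    intro f hf
    induction hf using NonUnitalStarAlgebra.adjoin_induction with
    | mem f hf =>
      obtain ⟨x, _, ⟨a, rfl⟩, rfl⟩ := hf
      exact hgen x a
    | add f g _ _ hf hg => exact hadd _ _ hf hg
    | zero => exact hzero
    | mul f g _ _ hf hg => exact hmul _ _ hf hg
    | smul r f _ hf => exact hsmul _ _ hf
    | star f _ hf => exact hstar _ hf
  obtain ⟨f, hf⟩ := d
  obtain ⟨u, hu, hlim⟩ := mem_closure_iff_seq_limit.mp hf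
  refine hc.mem_of_tendsto (b := atTop)
    (f := fun n => (⟨u n, NonUnitalStarSubalgebra.le_topologicalClosure _ (hu n)⟩ : AlgD φ M)) ?_
    (Eventually.of_forall fun n => key _ (hu n))
  exact tendsto_subtype_rng.mpr hlim

end AlgD

/-! ### The representation of `D` attached to an SU-family -/

section Rep

variable {N H : Type*} [Group N] [CommGroup H] {φ : H →* MulAut N} {M : Subgroup N}
  {B : Type*} [CStarAlgebra B] {S : HPlus φ M → B} {U : M → B}

theorem cosetInvariant_cosetChi (x : N) {a b : H}
    (hab : conjSubgroup φ M b ≤ conjSubgroup φ M a) :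
    CosetInvariant φ M b (AlgD.incl φ M (cosetChi φ M x a)) := by
  classical
  intro n k hk
  rw [incl_cosetChi, incl_cosetChi, ← mul_assoc]
  congr 1
  exact propext ((conjSubgroup φ M a).mul_mem_cancel_right (hab hk))

theorem IsExhausting.of_conjFamily
    (hbase : ∀ U ∈ conjFamily φ M, ∀ V ∈ conjFamily φ M, ∃ W ∈ conjFamily φ M, W ≤ U ⊓ V)
    (hfin : ∀ U ∈ conjFamily φ M, ∀ V ∈ conjFamily φ M, V ≤ U → Finite (U ⧸ V.subgroupOf U))
    (hN : (⋃ a : HPlus φ M, (conjSubgroup φ M (a : H)⁻¹ : Set N)) = Set.univ) :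
    IsExhausting φ M where
  exists_inv_mul_mem a := by
    -- The base property for `aMa⁻¹` and `M = 1M1⁻¹`: the inclusion in `M` says `e ∈ H⁺`, the other
    -- one `a⁻¹e ∈ H⁺`.
    obtain ⟨_, ⟨e, rfl⟩, he⟩ := hbase _ ⟨a, rfl⟩ _ ⟨1, rfl⟩
    rw [le_inf_iff, ← inv_mul_mem_HPlus, ← inv_mul_mem_HPlus] at he
    exact ⟨⟨e, by simpa using he.2⟩, he.1⟩
  exists_map_mem n := by
    obtain ⟨a, ha⟩ := Set.mem_iUnion.mp (hN.ge (Set.mem_univ n))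
    exact ⟨a, by simpa using mem_conjSubgroup.mp ha⟩
  finite_quotient a := by
    have h1 : conjSubgroup φ M 1 = M := by ext; simp [mem_conjSubgroup]
    have := hfin M ⟨1, h1⟩ _ ⟨a, rfl⟩ a.2
    have h2 : (conjHom φ M a).range = (conjSubgroup φ M a).subgroupOf M := by
      ext m
      rw [mem_range_conjHom, Subgroup.mem_subgroupOf]
    rwa [h2]

variable [hdir : IsExhausting φ M]

namespace IsSUFamily

/-- The functions on which the net `stepRep` converges. -/
def convergent (h : IsSUFamily φ M S U) : NonUnitalStarSubalgebra ℂ (LInfty N) where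
  carrier := {f | ∃ L, Tendsto (fun e => h.stepRep e f) atTop (𝓝 L)}
  add_mem' := by
    rintro f g ⟨L, hL⟩ ⟨L', hL'⟩
    exact ⟨L + L', by simpa only [map_add] using hL.add hL'⟩
  zero_mem' := ⟨0, by simpa only [map_zero] using tendsto_const_nhds⟩
  mul_mem' := by
    rintro f g ⟨L, hL⟩ ⟨L', hL'⟩
    exact ⟨L * L', by simpa only [map_mul] using hL.mul hL'⟩
  smul_mem' := by
    rintro r f ⟨L, hL⟩
    exact ⟨r • L, by simpa only [map_smul] using hL.const_smul r⟩
  star_mem' := by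
    rintro f ⟨L, hL⟩
    exact ⟨star L, by simpa only [map_star] using hL.star⟩

theorem norm_stepRep_le (h : IsSUFamily φ M S U) (e : HPlus φ M) (f : LInfty N) :
    ‖h.stepRep e f‖ ≤ ‖f‖ :=
  NonUnitalStarAlgHom.norm_apply_le (h.stepRep e) f

/-- All `stepRep e` are contractive, so a uniform approximation of `f` controls the whole net at
once; a three-epsilon estimate makes it Cauchy. -/
theorem isClosed_convergent (h : IsSUFamily φ M S U) : IsClosed (h.convergent : Set (LInfty N)) := by
  refine isClosed_of_closure_subset fun f hf => ?_
  refine cauchy_map_iff_exists_tendsto.mp (Metric.cauchy_iff.mpr ⟨inferInstance, fun ε hε => ?_⟩)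
  obtain ⟨g, ⟨L, hL⟩, hfg⟩ := Metric.mem_closure_iff.mp hf (ε / 3) (by positivity)
  obtain ⟨t, ht, hd⟩ := (Metric.cauchy_iff.mp hL.cauchy_map).2 (ε / 3) (by positivity)
  have hs : ∀ e, dist (h.stepRep e f) (h.stepRep e g) < ε / 3 := fun e => by
    rw [dist_eq_norm, ← map_sub]
    exact (h.norm_stepRep_le e _).trans_lt (by rwa [← dist_eq_norm])
  refine ⟨(fun e => h.stepRep e f) '' {e | h.stepRep e g ∈ t}, image_mem_map ht, ?_⟩
  rintro _ ⟨e, he, rfl⟩ _ ⟨e', he', rfl⟩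
  have h1 := hd _ he _ he'
  have h2 := hs e
  have h3 := hs e'
  rw [dist_comm] at h3
  calc _ ≤ _ := dist_triangle4 _ (h.stepRep e g) (h.stepRep e' g) _
    _ < ε := by linarith

theorem tendsto_stepRep_cosetChi (h : IsSUFamily φ M S U) (x : N) {a : H} {e : HPlus φ M}
    (he : conjSubgroup φ M (e : H) ≤ conjSubgroup φ M a) :
    Tendsto (fun e => h.stepRep e (AlgD.incl φ M (cosetChi φ M x a))) atTop
      (𝓝 (h.stepRep e (AlgD.incl φ M (cosetChi φ M x a)))) :=
  tendsto_const_nhds.congr' <| (eventually_ge_atTop e).mono fun _ he' =>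
    (h.stepRep_eq_of_le (cosetInvariant_cosetChi x he) he').symm

/-- On a generator `χ_{xaMa⁻¹}` the net is eventually constant, namely from any `e ∈ H⁺` with `eMe⁻¹
⊆ aMa⁻¹` on. -/
theorem algD_le_convergent (h : IsSUFamily φ M S U) : algD φ M ≤ h.convergent := by
  refine NonUnitalStarSubalgebra.topologicalClosure_minimal _
    (NonUnitalStarAlgebra.adjoin_le ?_) h.isClosed_convergent
  rintro _ ⟨x, _, ⟨a, rfl⟩, rfl⟩
  obtain ⟨e, he⟩ := hdir.exists_inv_mul_mem a
  exact ⟨_, h.tendsto_stepRep_cosetChi x (inv_mul_mem_HPlus.mp he)⟩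

theorem exists_tendsto (h : IsSUFamily φ M S U) (d : AlgD φ M) :
    ∃ L, Tendsto (fun e => h.stepRep e (AlgD.incl φ M d)) atTop (𝓝 L) :=
  h.algD_le_convergent d.2

/-- The representation of `D` with `χ_{m aMa⁻¹} ↦ U(m) S_a S_a^* U(m)^*`. -/
def rep (h : IsSUFamily φ M S U) : AlgD φ M →⋆ₙₐ[ℂ] B where
  toFun d := (h.exists_tendsto d).choose
  map_smul' r d := tendsto_nhds_unique (h.exists_tendsto _).choose_spec <| by
    simpa only [map_smul] using! (h.exists_tendsto d).choose_spec.const_smul r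
  map_zero' := tendsto_nhds_unique (h.exists_tendsto _).choose_spec <| by
    simpa only [map_zero] using tendsto_const_nhds
  map_add' d e := tendsto_nhds_unique (h.exists_tendsto _).choose_spec <| by
    simpa only [map_add] using (h.exists_tendsto d).choose_spec.add (h.exists_tendsto e).choose_spec
  map_mul' d e := tendsto_nhds_unique (h.exists_tendsto _).choose_spec <| by
    simpa only [map_mul] using (h.exists_tendsto d).choose_spec.mul (h.exists_tendsto e).choose_spec
  map_star' d := tendsto_nhds_unique (h.exists_tendsto _).choose_spec <| by
    simpa only [map_star] using (h.exists_tendsto d).choose_spec.star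

theorem tendsto_rep (h : IsSUFamily φ M S U) (d : AlgD φ M) :
    Tendsto (fun e => h.stepRep e (AlgD.incl φ M d)) atTop (𝓝 (h.rep d)) :=
  (h.exists_tendsto d).choose_spec

theorem rep_eq_stepRep (h : IsSUFamily φ M S U) {e : HPlus φ M} {d : AlgD φ M}
    (hd : CosetInvariant φ M e (AlgD.incl φ M d)) : h.rep d = h.stepRep e (AlgD.incl φ M d) :=
  tendsto_nhds_unique (h.tendsto_rep d) <| tendsto_const_nhds.congr' <|
    (eventually_ge_atTop e).mono fun _ he' => (h.stepRep_eq_of_le hd he').symm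

theorem rep_mul_rangeProj (h : IsSUFamily φ M S U) {e : HPlus φ M} {d : AlgD φ M}
    (hd : CosetInvariant φ M e (AlgD.incl φ M d)) (m : M) :
    h.rep d * h.rangeProj e m = AlgD.incl φ M d (m : N) • h.rangeProj e m := by
  rw [h.rep_eq_stepRep hd, h.stepRep_mul_rangeProj hd]

theorem rep_cosetChi (h : IsSUFamily φ M S U) (m : M) (e : HPlus φ M) :
    h.rep (cosetChi φ M m e) = h.rangeProj e m := by
  classical
  refine h.ext_rangeProj e fun k => ?_
  rw [h.rep_mul_rangeProj (cosetInvariant_cosetChi _ le_rfl), incl_cosetChi]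
  have hiff : (m : N)⁻¹ * k ∈ conjSubgroup φ M e ↔ m⁻¹ * k ∈ (conjHom φ M e).range := by
    rw [mem_range_conjHom]; simp
  by_cases hmk : m⁻¹ * k ∈ (conjHom φ M e).range
  · rw [if_pos (hiff.mpr hmk), h.rangeProj_eq_of_mem hmk, one_smul,
      (h.isStarProjection_rangeProj e m).isIdempotentElem.eq]
  · rw [if_neg (hiff.not.mpr hmk), h.rangeProj_mul_of_notMem hmk, zero_smul]

theorem rep_chiM (h : IsSUFamily φ M S U) : h.rep (chiM φ M) = 1 := by
  have h1 := h.rep_cosetChi 1 1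
  rw [rangeProj, h.S_one, inv_one, h.U_one, star_one, mul_one, mul_one, mul_one] at h1
  rw [chiM_eq_cosetChi, ← h1]
  rfl

theorem norm_rep_le (h : IsSUFamily φ M S U) (d : AlgD φ M) : ‖h.rep d‖ ≤ ‖d‖ :=
  NonUnitalStarAlgHom.norm_apply_le h.rep d

end IsSUFamily

end Rep

theorem norm_le_one_of_star_mul_self {B : Type*} [CStarAlgebra B] {x : B} (hx : star x * x = 1) :
    ‖x‖ ≤ 1 := by
  have h1 := CStarRing.norm_star_mul_self (x := x)
  have h2 := CStarRing.norm_star_mul_self (x := (1 : B))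
  rw [star_one, one_mul] at h2
  rw [hx] at h1
  have h3 : ‖(1 : B)‖ ≤ 1 := by
    by_contra! h3
    nlinarith
  by_contra! h4
  nlinarith

theorem norm_alpha {N H : Type*} [Group N] [Group H] {φ : H →* MulAut N} {M : Subgroup N}
    (g : N ⋊[φ] H) (d : AlgD φ M) : ‖alpha φ M g d‖ = ‖d‖ :=
  NonUnitalStarAlgHom.norm_map (alpha φ M g) (alpha φ M g).injective d

/-! ### Elements of `N ⋊ H` as fractions `b⁻¹mc` -/

section Word

variable {N H : Type*} [Group N] [CommGroup H] {φ : H →* MulAut N} {M : Subgroup N}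

/-- The element `b⁻¹mc` of `N ⋊ H`. -/
def fracWord (b : HPlus φ M) (m : M) (c : HPlus φ M) : N ⋊[φ] H :=
  SemidirectProduct.inr (b : H)⁻¹ * SemidirectProduct.inl (m : N) * SemidirectProduct.inr (c : H)

theorem fracWord_eq_mk (b : HPlus φ M) (m : M) (c : HPlus φ M) :
    fracWord b m c = ⟨φ (b : H)⁻¹ m, (b : H)⁻¹ * c⟩ := by
  ext <;> simp [fracWord]

/-- Expansion of a fraction by `e`; it serves to bring two fractions to a common denominator. -/
theorem fracWord_expand (e b : HPlus φ M) (m : M) (c : HPlus φ M) :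
    fracWord (e * b) (conjHom φ M e m) (e * c) = fracWord b m c := by
  rw [fracWord_eq_mk, fracWord_eq_mk]
  ext
  · change φ ((e : H) * b)⁻¹ (φ (e : H) m) = φ (b : H)⁻¹ m
    rw [← MulAut.mul_apply, ← map_mul, mul_inv_rev, inv_mul_cancel_right]
  · simp [mul_assoc]

theorem fracWord_mul_fracWord (b : HPlus φ M) (m : M) (c : HPlus φ M) (k : M) (d : HPlus φ M) :
    fracWord b m c * fracWord c k d = fracWord b (m * k) d := by
  simp [fracWord, mul_assoc]

theorem fracWord_inv (b : HPlus φ M) (m : M) (c : HPlus φ M) :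
    (fracWord b m c)⁻¹ = fracWord c m⁻¹ b := by
  simp [fracWord, mul_assoc]

theorem fracWord_eq_iff {b c b' c' : HPlus φ M} {m m' : M}
    (hw : fracWord b m c = fracWord b' m' c') :
    conjHom φ M b' m = conjHom φ M b m' ∧ b' * c = b * c' := by
  rw [fracWord_eq_mk, fracWord_eq_mk] at hw
  have h1 : φ (b : H)⁻¹ m = φ (b' : H)⁻¹ m' := congrArg SemidirectProduct.left hw
  have h2 : (b : H)⁻¹ * c = (b' : H)⁻¹ * c' := congrArg SemidirectProduct.right hw
  constructor
  · refine Subtype.ext ?_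
    -- Conjugation by `bb'` clears both denominators; commutativity of `H` cancels `b` on one side
    -- and `b'` on the other.
    have h3 := congrArg (φ ((b * b' : HPlus φ M) : H)) h1
    simp only [← MulAut.mul_apply, ← map_mul, Submonoid.coe_mul, mul_inv_cancel_right] at h3
    rw [mul_right_comm, mul_inv_cancel, one_mul] at h3
    exact h3
  · refine Subtype.ext ?_
    have h3 := congrArg (fun x => (b : H) * b' * x) h2
    simp only [mul_inv_cancel_left, mul_assoc] at h3
    rw [mul_left_comm, mul_inv_cancel_left] at h3
    exact h3

theorem exists_fracWord [hdir : IsExhausting φ M] (g : N ⋊[φ] H) :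
    ∃ b m c, g = fracWord (M := M) b m c := by
  obtain ⟨a, ha⟩ := hdir.exists_map_mem g.left
  obtain ⟨e, he⟩ := hdir.exists_inv_mul_mem g.right
  -- With `g = nh`, `ana⁻¹ ∈ M` and `q = h⁻¹e ∈ H⁺`, the element `n = a⁻¹(ana⁻¹)a` and the fraction
  -- `h = q⁻¹e` are put over the common denominator `b = qa`.
  refine ⟨⟨_, he⟩ * a, conjHom φ M ⟨_, he⟩ ⟨_, ha⟩, e * a, ?_⟩
  rw [fracWord_eq_mk]
  ext
  · simp
  · change g.right = (g.right⁻¹ * e * a)⁻¹ * (e * a)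
    rw [mul_assoc, mul_inv_rev, inv_inv, mul_right_comm, inv_mul_cancel, one_mul]

end Word

/-! ### The partial representation of `G` and its covariance -/

namespace IsSUFamily

variable {N H : Type*} [Group N] [CommGroup H] {φ : H →* MulAut N} {M : Subgroup N}
  {B : Type*} [CStarAlgebra B] {S : HPlus φ M → B} {U : M → B}

/-- The right-hand factor `S e` moves to the left through `U` and meets `star (S e)`; the two cancel
because `S e` is an isometry. -/
theorem star_S_mul_U_mul_S_expand (h : IsSUFamily φ M S U) (e b : HPlus φ M) (m : M)
    (c : HPlus φ M) :
    star (S (e * b)) * U (conjHom φ M e m) * S (e * c) = star (S b) * U m * S c := by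
  have h1 : U (conjHom φ M e m) * S (e * c) = S e * (U m * S c) := by
    rw [← h.S_mul_S, ← mul_assoc, ← h.S_mul_U, mul_assoc]
  rw [mul_assoc, h1, ← h.S_mul_S, star_mul, mul_assoc, ← mul_assoc (star (S e)), h.isometry, one_mul,
    mul_assoc]

theorem star_S_mul_U_mul_S_eq (h : IsSUFamily φ M S U) {b c b' c' : HPlus φ M} {m m' : M}
    (hw : fracWord b m c = fracWord b' m' c') :
    star (S b) * U m * S c = star (S b') * U m' * S c' := by
  obtain ⟨h1, h2⟩ := fracWord_eq_iff hw
  rw [← h.star_S_mul_U_mul_S_expand b' b, ← h.star_S_mul_U_mul_S_expand b b', h1, h2,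
    mul_comm b' b]

theorem U_mul_rangeProj (h : IsSUFamily φ M S U) (e : HPlus φ M) (m k : M) :
    U m * h.rangeProj e k = h.rangeProj e (m * k) * U m := by
  rw [rangeProj, rangeProj, ← mul_assoc, ← mul_assoc, ← mul_assoc, h.U_mul_U,
    mul_assoc _ (U (m * k)⁻¹) (U m), h.U_mul_U, mul_inv_rev, inv_mul_cancel_right]

theorem S_mul_rangeProj (h : IsSUFamily φ M S U) (c e : HPlus φ M) (m : M) :
    S c * h.rangeProj e m = h.rangeProj (c * e) (conjHom φ M c m) * S c := by
  have h1 : star (S (c * e)) * U (conjHom φ M c m)⁻¹ * S c = star (S e) * U m⁻¹ := by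
    have := h.star_S_mul_U_mul_S_expand c e m⁻¹ 1
    rwa [mul_one, h.S_one, mul_one, map_inv] at this
  have h2 : S c * (U m * S e) = U (conjHom φ M c m) * S (c * e) := by
    rw [← mul_assoc, h.S_mul_U, mul_assoc, h.S_mul_S]
  rw [rangeProj, rangeProj]
  simp only [mul_assoc] at h1 ⊢
  rw [h1, ← mul_assoc (U _) (S (c * e)), ← h2]
  simp only [mul_assoc]

variable [hdir : IsExhausting φ M]

theorem mul_rep_of_cosetChi (h : IsSUFamily φ M S U) {T : B} {g : N ⋊[φ] H}
    (hT : ∀ x a, T * h.rep (cosetChi φ M x a) = h.rep (alpha φ M g (cosetChi φ M x a)) * T)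
    (d : AlgD φ M) : T * h.rep d = h.rep (alpha φ M g d) * T := by
  have hα : Continuous fun d => alpha φ M g d := by
    refine AddMonoidHomClass.continuous_of_bound (alpha φ M g) 1 fun d => ?_
    rw [one_mul]
    exact (norm_alpha g d).le
  have hr : Continuous h.rep :=
    AddMonoidHomClass.continuous_of_bound h.rep 1 fun d => by rw [one_mul]; exact h.norm_rep_le d
  -- The relation for `d` alone does not pass to `star d`, since taking adjoints replaces `T` by
  -- `star T`; hence both are carried along.
  refine (AlgD.induction (P := fun d => T * h.rep d = h.rep (alpha φ M g d) * T ∧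
    T * h.rep (star d) = h.rep (alpha φ M g (star d)) * T) d ?_ ?_ ?_ ?_ ?_ ?_ ?_).1
  · refine IsClosed.inter (isClosed_eq ?_ ?_) (isClosed_eq ?_ ?_) <;> fun_prop
  · intro x a
    rw [star_cosetChi]
    exact ⟨hT x a, hT x a⟩
  · simp
  · rintro d e ⟨hd, hd'⟩ ⟨he, he'⟩
    simp only [star_add, map_add, mul_add, add_mul, hd, hd', he, he', and_self]
  · rintro d e ⟨hd, hd'⟩ ⟨he, he'⟩
    constructor
    · rw [map_mul, map_mul, map_mul, ← mul_assoc, hd, mul_assoc, he, mul_assoc]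
    · rw [star_mul, map_mul, map_mul, map_mul, ← mul_assoc, he', mul_assoc, hd', mul_assoc]
  · rintro r d ⟨hd, hd'⟩
    simp only [star_smul, map_smul, mul_smul_comm, smul_mul_assoc, hd, hd', and_self]
  · rintro d ⟨hd, hd'⟩
    exact ⟨hd', by rwa [star_star]⟩

theorem U_mul_rep (h : IsSUFamily φ M S U) (m : M) (d : AlgD φ M) :
    U m * h.rep d = h.rep (alpha φ M (SemidirectProduct.inl (m : N)) d) * U m := by
  refine h.mul_rep_of_cosetChi (fun x a => ?_) d
  obtain ⟨e, he⟩ := hdir.exists_inv_mul_mem a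
  have he := inv_mul_mem_HPlus.mp he
  refine h.ext_rangeProj e fun k => ?_
  rw [mul_assoc, h.rep_mul_rangeProj (cosetInvariant_cosetChi x he), mul_assoc, h.U_mul_rangeProj,
    ← mul_assoc, h.rep_mul_rangeProj, mul_smul_comm, h.U_mul_rangeProj, smul_mul_assoc, incl_alpha,
    beta_apply]
  · simp
  · rw [alpha_cosetChi]
    refine cosetInvariant_cosetChi _ ?_
    simpa using he

theorem S_mul_rep (h : IsSUFamily φ M S U) (c : HPlus φ M) (d : AlgD φ M) :
    S c * h.rep d = h.rep (alpha φ M (SemidirectProduct.inr (c : H)) d) * S c := by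
  refine h.mul_rep_of_cosetChi (fun x a => ?_) d
  obtain ⟨e, he⟩ := hdir.exists_inv_mul_mem a
  refine h.ext_rangeProj e fun k => ?_
  rw [mul_assoc, h.rep_mul_rangeProj (cosetInvariant_cosetChi x (inv_mul_mem_HPlus.mp he)),
    mul_assoc, h.S_mul_rangeProj,
    ← mul_assoc, h.rep_mul_rangeProj, mul_smul_comm, h.S_mul_rangeProj, smul_mul_assoc, incl_alpha,
    beta_apply]
  · simp
  · rw [alpha_cosetChi]
    refine cosetInvariant_cosetChi _ (inv_mul_mem_HPlus.mp ?_)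
    simpa [mul_assoc] using he

theorem star_S_mul_rep (h : IsSUFamily φ M S U) (c : HPlus φ M) (d : AlgD φ M) :
    star (S c) * h.rep d = h.rep (alpha φ M (SemidirectProduct.inr (c : H)⁻¹) d) * star (S c) := by
  -- The adjoint of the covariance relation for `S c`, taken at `α_{c⁻¹}(d)^*`, so that the two
  -- automorphisms cancel on one side.
  have h1 := congrArg star
    (h.S_mul_rep c (star (alpha φ M (SemidirectProduct.inr (c : H)⁻¹) d)))
  simp only [star_mul, ← map_star, star_star] at h1
  rw [← StarAlgEquiv.mul_apply, ← map_mul, ← map_mul, mul_inv_cancel, map_one, map_one,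
    StarAlgEquiv.one_apply] at h1
  exact h1.symm

/-- The partial representation `b⁻¹mc ↦ S_b^* U(m) S_c` of `N ⋊ H`. -/
def partialRep (_h : IsSUFamily φ M S U) (g : N ⋊[φ] H) : B :=
  star (S (exists_fracWord (M := M) g).choose) *
    U (exists_fracWord (M := M) g).choose_spec.choose *
    S (exists_fracWord (M := M) g).choose_spec.choose_spec.choose

theorem partialRep_fracWord (h : IsSUFamily φ M S U) (b : HPlus φ M) (m : M) (c : HPlus φ M) :
    h.partialRep (fracWord b m c) = star (S b) * U m * S c :=
  h.star_S_mul_U_mul_S_eq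
    (exists_fracWord (M := M) (fracWord b m c)).choose_spec.choose_spec.choose_spec.symm

theorem partialRep_inl (h : IsSUFamily φ M S U) (m : M) :
    h.partialRep (SemidirectProduct.inl (m : N)) = U m := by
  have h1 : (SemidirectProduct.inl (m : N) : N ⋊[φ] H) = fracWord 1 m 1 := by simp [fracWord]
  rw [h1, h.partialRep_fracWord, h.S_one, star_one, one_mul, mul_one]

theorem partialRep_inr (h : IsSUFamily φ M S U) (a : HPlus φ M) :
    h.partialRep (SemidirectProduct.inr (a : H)) = S a := by
  have h1 : (SemidirectProduct.inr (a : H) : N ⋊[φ] H) = fracWord (M := M) 1 1 a := by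
    simp [fracWord]
  rw [h1, h.partialRep_fracWord, h.S_one, h.U_one, star_one, one_mul, one_mul]

theorem partialRep_inv (h : IsSUFamily φ M S U) (g : N ⋊[φ] H) :
    h.partialRep g⁻¹ = star (h.partialRep g) := by
  obtain ⟨b, m, c, rfl⟩ := exists_fracWord (M := M) g
  rw [fracWord_inv, h.partialRep_fracWord, h.partialRep_fracWord, star_mul, star_mul, star_star,
    h.star_U, mul_assoc]

theorem partialRep_mul_rep (h : IsSUFamily φ M S U) (g : N ⋊[φ] H) (d : AlgD φ M) :
    h.partialRep g * h.rep d = h.rep (alpha φ M g d) * h.partialRep g := by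
  obtain ⟨b, m, c, rfl⟩ := exists_fracWord (M := M) g
  rw [h.partialRep_fracWord, mul_assoc, h.S_mul_rep, mul_assoc, ← mul_assoc (U m), h.U_mul_rep,
    ← mul_assoc, ← mul_assoc, h.star_S_mul_rep, fracWord, map_mul, map_mul, StarAlgEquiv.mul_apply,
    StarAlgEquiv.mul_apply]
  simp only [mul_assoc]

/-- For `g = b⁻¹mc` and `k = c⁻¹m'c'` the only obstruction to multiplicativity is the factor `S c *
star (S c)` in the middle. It equals `rep` of `χ_{cMc⁻¹}`, and covariance moves it to the far left
as `rep (α_g χ_M)`. -/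
theorem partialRep_mul (h : IsSUFamily φ M S U) (g k : N ⋊[φ] H) :
    h.partialRep g * h.partialRep k = h.rep (alpha φ M g (chiM φ M)) * h.partialRep (g * k) := by
  obtain ⟨b, m, c, rfl⟩ := exists_fracWord (M := M) g
  obtain ⟨b', m', c', rfl⟩ := exists_fracWord (M := M) k
  -- Expanding `g` by `b'` and `k` by `c` makes the numerator `b'c` of `g` equal to the denominator
  -- `cb'` of `k`.
  rw [← fracWord_expand b' b, ← fracWord_expand c b', mul_comm b' c, fracWord_mul_fracWord,
    h.partialRep_fracWord, h.partialRep_fracWord, h.partialRep_fracWord]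
  generalize b' * b = b, conjHom φ M b' m = m, c * b' = c, conjHom φ M c m' = m', c * c' = c'
  have h1 : S c * star (S c) = h.rep (alpha φ M (SemidirectProduct.inr (c : H)) (chiM φ M)) := by
    have := h.rep_cosetChi 1 c
    rw [alpha_chiM, SemidirectProduct.left_inr, SemidirectProduct.right_inr]
    rw [rangeProj, inv_one, h.U_one, one_mul, mul_one] at this
    exact this.symm
  rw [← h.U_mul_U]
  calc _ = star (S b) * (U m * (S c * star (S c))) * (U m' * S c') := by simp only [mul_assoc]
    _ = _ := by
      rw [h1, h.U_mul_rep, ← mul_assoc (star (S b)), ← mul_assoc (star (S b)), h.star_S_mul_rep,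
        fracWord, map_mul, map_mul,
        StarAlgEquiv.mul_apply, StarAlgEquiv.mul_apply]
      simp only [mul_assoc]

theorem norm_partialRep_le (h : IsSUFamily φ M S U) (g : N ⋊[φ] H) : ‖h.partialRep g‖ ≤ 1 := by
  obtain ⟨b, m, c, rfl⟩ := exists_fracWord (M := M) g
  have h1 := norm_le_one_of_star_mul_self (h.isometry b)
  have h2 := norm_le_one_of_star_mul_self (h.isometry c)
  have h3 := norm_le_one_of_star_mul_self (Unitary.star_mul_self_of_mem (h.unitary m))
  rw [h.partialRep_fracWord]
  calc _ ≤ ‖star (S b)‖ * ‖U m‖ * ‖S c‖ :=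
        (norm_mul_le _ _).trans (by gcongr; exact norm_mul_le _ _)
    _ ≤ 1 * 1 * 1 := by rw [norm_star]; gcongr
    _ = 1 := by norm_num

end IsSUFamily

theorem IsStarProjection.norm_le_one {A : Type*} [NonUnitalCStarAlgebra A] {p : A}
    (hp : IsStarProjection p) : ‖p‖ ≤ 1 := by
  have h1 := CStarRing.norm_star_mul_self (x := p)
  rw [hp.isSelfAdjoint.star_eq, hp.isIdempotentElem.eq] at h1
  by_contra! h
  nlinarith

/-! ### The approximate unit `χ_{b⁻¹Mb}` of `D` -/

section ApproximateUnit

variable {N H : Type*} [Group N] [CommGroup H] {φ : H →* MulAut N} {M : Subgroup N}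

/-- The projections `χ_{b⁻¹Mb}`, `b ∈ H⁺`. -/
def unitProj (φ : H →* MulAut N) (M : Subgroup N) (b : HPlus φ M) : AlgD φ M :=
  alpha φ M (SemidirectProduct.inr (b : H)⁻¹) (chiM φ M)

theorem norm_unitProj_le (b : HPlus φ M) : ‖unitProj φ M b‖ ≤ 1 := by
  rw [unitProj, norm_alpha]
  exact (isStarProjection_chiM φ M).norm_le_one

theorem star_unitProj (b : HPlus φ M) : star (unitProj φ M b) = unitProj φ M b := by
  rw [unitProj, ← map_star, (isStarProjection_chiM φ M).isSelfAdjoint.star_eq]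

theorem alpha_unitProj_mul (b : HPlus φ M) (e : AlgD φ M) :
    alpha φ M (SemidirectProduct.inr (b : H)) (unitProj φ M b * e) =
      chiM φ M * alpha φ M (SemidirectProduct.inr (b : H)) e := by
  rw [map_mul, unitProj, ← StarAlgEquiv.mul_apply, ← map_mul, ← map_mul, mul_inv_cancel, map_one,
    map_one, StarAlgEquiv.one_apply]

variable [hdir : IsExhausting φ M]

theorem eventually_unitProj_mul_cosetChi (x : N) (a : H) :
    ∀ᶠ b in atTop, unitProj φ M b * cosetChi φ M x a = cosetChi φ M x a := by
  classical
  obtain ⟨c, hc⟩ := hdir.exists_map_mem x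
  obtain ⟨e, he⟩ := hdir.exists_inv_mul_mem a⁻¹
  rw [inv_inv] at he
  -- Here `cxc⁻¹ ∈ M` and `ae ∈ H⁺`; any multiple of `ce` therefore conjugates both `x` and `aMa⁻¹`,
  -- hence the whole coset `xaMa⁻¹`, into `M`.
  refine (eventually_ge_atTop (c * e)).mono ?_
  rintro _ ⟨d, rfl⟩
  refine AlgD.ext fun y => ?_
  rw [unitProj, alpha_chiM, map_mul]
  change AlgD.incl φ M _ y * AlgD.incl φ M _ y = _
  rw [incl_cosetChi, incl_cosetChi]
  by_cases hy : x⁻¹ * y ∈ conjSubgroup φ M a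
  · rw [if_pos hy, if_pos, mul_one]
    rw [mem_conjSubgroup] at hy ⊢
    have h1 : φ ((c * e * d : HPlus φ M) : H) x ∈ M := by
      have h2 : φ ((c * e * d : HPlus φ M) : H) x = φ ((e * d : HPlus φ M) : H) (φ c x) := by
        rw [mul_assoc, mul_comm, Submonoid.coe_mul, map_mul, MulAut.mul_apply]
      rw [h2]
      exact mem_HPlus.mp (e * d).2 _ hc
    have h3 : φ ((c * e * d : HPlus φ M) : H) (x⁻¹ * y) ∈ M := by
      have h4 : φ ((c * e * d : HPlus φ M) : H) (x⁻¹ * y) =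
          φ ((c * ⟨_, he⟩ * d : HPlus φ M) : H) (φ a⁻¹ (x⁻¹ * y)) := by
        rw [← MulAut.mul_apply, ← map_mul]
        congr 2
        change (c * e * d : H) = c * (a * e) * d * a⁻¹
        rw [mul_comm a, ← mul_assoc (c : H), mul_right_comm _ a, mul_inv_cancel_right]
      rw [h4]
      exact mem_HPlus.mp (c * ⟨_, he⟩ * d).2 _ hy
    have h5 := M.mul_mem h1 h3
    rw [← map_mul, mul_inv_cancel_left] at h5
    simpa using h5
  · rw [if_neg hy, mul_zero]

/-- The net is bounded by `1`, so convergence passes to norm limits; on the generators it is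
eventually an equality. -/
theorem tendsto_unitProj_mul (e : AlgD φ M) :
    Tendsto (fun b => unitProj φ M b * e) atTop (𝓝 e) := by
  induction e using AlgD.induction with
  | hc =>
    refine isClosed_of_closure_subset fun e he => ?_
    refine Metric.tendsto_nhds.mpr fun ε hε => ?_
    obtain ⟨e', he', hd⟩ := Metric.mem_closure_iff.mp he (ε / 3) (by positivity)
    filter_upwards [Metric.tendsto_nhds.mp he' (ε / 3) (by positivity)] with b hb
    have h1 : dist (unitProj φ M b * e) (unitProj φ M b * e') < ε / 3 := by
      rw [dist_eq_norm, ← mul_sub]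
      calc _ ≤ ‖unitProj φ M b‖ * ‖e - e'‖ := norm_mul_le _ _
        _ ≤ 1 * ‖e - e'‖ := by gcongr; exact norm_unitProj_le b
        _ < ε / 3 := by rwa [one_mul, ← dist_eq_norm]
    rw [dist_comm] at hd
    have := dist_triangle4 (unitProj φ M b * e) (unitProj φ M b * e') e' e
    linarith
  | hgen x a =>
    exact tendsto_const_nhds.congr' <|
      (eventually_unitProj_mul_cosetChi x a).mono fun _ hb => hb.symm
  | hzero => simpa only [mul_zero] using tendsto_const_nhds
  | hadd d e hd he => simpa only [mul_add] using hd.add he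
  | hmul d e hd he => simpa only [mul_assoc] using hd.mul_const e
  | hsmul r d hd => simpa only [mul_smul_comm] using hd.const_smul r
  | hstar d hd =>
    refine hd.star.congr fun b => ?_
    rw [star_mul, star_unitProj, AlgD.mul_comm]

end ApproximateUnit

/-! ### The bound by the universal norm and the extension to `A` -/

namespace CovAlg

variable {G D : Type*} [Group G] [NonUnitalCStarAlgebra D] {α : G →* (D ≃⋆ₐ[ℂ] D)}

theorem norm_le_l1Norm_of_single {B : Type*} [SeminormedAddCommGroup B] (T : CovAlg α →+ B)
    (hT : ∀ g d, ‖T (single α g d)‖ ≤ ‖d‖) (f : CovAlg α) : ‖T f‖ ≤ l1Norm f := by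
  have h1 : f = ∑ g ∈ Finsupp.support (M := D) f, single α g (Finsupp.instFunLike.coe f g) :=
    (Finsupp.sum_single (M := D) f).symm
  conv_lhs => rw [h1]
  rw [map_sum]
  exact norm_sum_le_of_le _ fun g _ => hT g _

end CovAlg

namespace IsSUFamily

variable {N H : Type*} [Group N] [CommGroup H] {φ : H →* MulAut N} {M : Subgroup N}
  {B : Type*} [CStarAlgebra B] {S : HPlus φ M → B} {U : M → B} [hdir : IsExhausting φ M]

open CovAlg

/-- The map `d · g ↦ rep d * partialRep g`, multiplicative on the corner at `χ_M`. -/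
def covRep (h : IsSUFamily φ M S U) : CovAlg (alpha φ M) →+ B :=
  lift _ fun g => (AddMonoidHom.mulRight (h.partialRep g)).comp (h.rep : AlgD φ M →+ B)

theorem covRep_single (h : IsSUFamily φ M S U) (g : N ⋊[φ] H) (d : AlgD φ M) :
    h.covRep (single _ g d) = h.rep d * h.partialRep g :=
  lift_single _ g d

theorem covRep_smul (h : IsSUFamily φ M S U) (r : ℂ) (f : CovAlg (alpha φ M)) :
    h.covRep (r • f) = r • h.covRep f := by
  induction f using CovAlg.induction with
  | h0 => simp
  | hadd f f' hf hf' => simp only [smul_add, map_add, hf, hf']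
  | hs s d => rw [smul_single, covRep_single, covRep_single, map_smul, smul_mul_assoc]

/-- Moving the inserted `χ_M` past the group element `s` produces `α_s(χ_M)`, which is exactly the
defect in `partialRep_mul`. -/
theorem covRep_mul (h : IsSUFamily φ M S U) (f k : CovAlg (alpha φ M)) :
    h.covRep (f * single _ 1 (chiM φ M) * k) = h.covRep f * h.covRep k := by
  induction f using CovAlg.induction with
  | h0 => simp
  | hadd f f' hf hf' => simp only [add_mul, map_add, hf, hf']
  | hs s d =>
    induction k using CovAlg.induction with
    | h0 => simp
    | hadd f f' hf hf' => simp only [mul_add, map_add, hf, hf']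
    | hs t e =>
      rw [single_mul_single, single_mul_single, covRep_single, covRep_single, covRep_single,
        mul_one, map_mul, map_mul, mul_assoc, mul_assoc, mul_assoc, ← mul_assoc (h.partialRep s),
        h.partialRep_mul_rep, mul_assoc (h.rep (alpha φ M s e)), h.partialRep_mul, ← mul_assoc
        (h.rep (alpha φ M s e)), ← map_mul, AlgD.mul_comm, map_mul, mul_assoc]

theorem covRep_star (h : IsSUFamily φ M S U) (f : CovAlg (alpha φ M)) :
    h.covRep (star f) = star (h.covRep f) := by
  induction f using CovAlg.induction with
  | h0 => simp
  | hadd f f' hf hf' => simp only [star_add, map_add, hf, hf']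
  | hs s d =>
    rw [star_single, covRep_single, covRep_single, ← h.partialRep_mul_rep, star_mul,
      h.partialRep_inv, map_star]

theorem norm_covRep_single_le (h : IsSUFamily φ M S U) (g : N ⋊[φ] H) (d : AlgD φ M) :
    ‖h.covRep (single _ g d)‖ ≤ ‖d‖ := by
  rw [covRep_single]
  calc _ ≤ ‖h.rep d‖ * ‖h.partialRep g‖ := norm_mul_le _ _
    _ ≤ ‖d‖ * 1 := by gcongr; exacts [h.norm_rep_le d, h.norm_partialRep_le g]
    _ = ‖d‖ := mul_one _

/-- Only values on `M ⊆ c⁻¹Mc` matter to `rep`. Algebraically, covariance of `star (S c)` with `χ_M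
↦ 1` gives `star (S c) = rep (χ_{c⁻¹Mc}) * star (S c)`, and `S c` is cancelled on the right. -/
theorem rep_unitProj (h : IsSUFamily φ M S U) (c : HPlus φ M) :
    h.rep (unitProj φ M c) = 1 := by
  have h1 := h.star_S_mul_rep c (chiM φ M)
  rw [h.rep_chiM, mul_one] at h1
  rw [← mul_one (h.rep _), ← h.isometry c, ← mul_assoc]
  exact congrArg (· * S c) h1.symm

/-- The map `f ↦ covRep (b f b⁻¹)`. -/
def conjRep (h : IsSUFamily φ M S U) (b : HPlus φ M) : CovAlg (alpha φ M) →+ B :=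
  h.covRep.comp ((rightAdd _ (SemidirectProduct.inr (b : H))⁻¹).comp
    (leftAdd _ (SemidirectProduct.inr (b : H))))

theorem conjRep_single (h : IsSUFamily φ M S U) (b : HPlus φ M) (g : N ⋊[φ] H) (d : AlgD φ M) :
    h.conjRep b (single _ g d) =
      h.covRep (single _ (SemidirectProduct.inr (b : H) * g * (SemidirectProduct.inr (b : H))⁻¹)
        (alpha φ M (SemidirectProduct.inr (b : H)) d)) := by
  rw [conjRep, AddMonoidHom.comp_apply, AddMonoidHom.comp_apply, leftAdd_single, rightAdd_single]

theorem conjRep_one (h : IsSUFamily φ M S U) (f : CovAlg (alpha φ M)) :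
    h.conjRep 1 f = h.covRep f := by
  rw [conjRep, AddMonoidHom.comp_apply, AddMonoidHom.comp_apply, Submonoid.coe_one, map_one,
    leftAdd_one, inv_one, rightAdd_one]

theorem conjRep_smul (h : IsSUFamily φ M S U) (b : HPlus φ M) (r : ℂ) (f : CovAlg (alpha φ M)) :
    h.conjRep b (r • f) = r • h.conjRep b f := by
  rw [conjRep, AddMonoidHom.comp_apply, AddMonoidHom.comp_apply, leftAdd_smul, rightAdd_smul,
    covRep_smul]
  rfl

theorem conjRep_star (h : IsSUFamily φ M S U) (b : HPlus φ M) (f : CovAlg (alpha φ M)) :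
    h.conjRep b (star f) = star (h.conjRep b f) := by
  induction f using CovAlg.induction with
  | h0 => simp
  | hadd f f' hf hf' => simp only [star_add, map_add, hf, hf']
  | hs s d =>
    rw [star_single, conjRep_single, conjRep_single, ← covRep_star, star_single, ← map_star,
      ← StarAlgEquiv.mul_apply, ← map_mul, ← StarAlgEquiv.mul_apply, ← map_mul]
    congr 3 <;> simp [mul_assoc]

theorem norm_conjRep_single_le (h : IsSUFamily φ M S U) (b : HPlus φ M) (g : N ⋊[φ] H)
    (d : AlgD φ M) : ‖h.conjRep b (single _ g d)‖ ≤ ‖d‖ := by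
  rw [conjRep_single]
  exact (h.norm_covRep_single_le _ _).trans (norm_alpha _ d).le

theorem norm_conjRep_le (h : IsSUFamily φ M S U) (b : HPlus φ M) (f : CovAlg (alpha φ M)) :
    ‖h.conjRep b f‖ ≤ l1Norm f :=
  norm_le_l1Norm_of_single _ (h.norm_conjRep_single_le b) f

/-- The compression to `χ_{b⁻¹Mb}` is recovered from the one to the larger projection
`χ_{(cb)⁻¹Mcb}`. The isometry `S c` is `W_c`, and both defects that arise in multiplying the `W`'s
reduce to `rep (χ_{c⁻¹Mc}) = 1`. This makes the norms increase with `b`. -/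
theorem star_S_mul_conjRep_mul_S (h : IsSUFamily φ M S U) (c b : HPlus φ M)
    (f : CovAlg (alpha φ M)) :
    star (S c) * h.conjRep (c * b) f * S c = h.conjRep b f := by
  induction f using CovAlg.induction with
  | h0 => simp
  | hadd f f' hf hf' => simp only [mul_add, add_mul, map_add, hf, hf']
  | hs s d =>
    rw [conjRep_single, conjRep_single, covRep_single, covRep_single, ← mul_assoc, h.star_S_mul_rep]
    have h1 : star (S c) = h.partialRep (SemidirectProduct.inr (c : H)⁻¹) := by
      rw [map_inv, h.partialRep_inv, h.partialRep_inr]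
    rw [h1, ← h.partialRep_inr c, mul_assoc (h.rep _), h.partialRep_mul]
    change h.rep _ * (h.rep (unitProj φ M c) * _) * _ = _
    rw [h.rep_unitProj, one_mul, mul_assoc, h.partialRep_mul, ← StarAlgEquiv.mul_apply, ← map_mul]
    generalize hx : SemidirectProduct.inr (b : H) * s * (SemidirectProduct.inr (b : H))⁻¹ = x
    have h2 : SemidirectProduct.inr (c : H)⁻¹ *
        (SemidirectProduct.inr ((c * b : HPlus φ M) : H) * s *
          (SemidirectProduct.inr ((c * b : HPlus φ M) : H))⁻¹) =
        x * (SemidirectProduct.inr (c : H)⁻¹ : N ⋊[φ] H) := by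
      rw [← hx]
      simp [mul_assoc]
    have h3 : SemidirectProduct.inr (c : H)⁻¹ * SemidirectProduct.inr ((c * b : HPlus φ M) : H) =
        (SemidirectProduct.inr (b : H) : N ⋊[φ] H) := by
      simp
    rw [h2, h3, mul_assoc x, ← map_mul, inv_mul_cancel, map_one, mul_one, map_mul,
      StarAlgEquiv.mul_apply]
    -- The second defect carries the automorphism `α_x`; moving it back through `W_x` removes `α_x`
    -- and leaves `rep (χ_{c⁻¹Mc}) = 1`.
    change _ * (h.rep (alpha φ M x (unitProj φ M c)) * _) = _
    rw [← h.partialRep_mul_rep, h.rep_unitProj, mul_one]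

theorem monotone_norm_conjRep (h : IsSUFamily φ M S U) (f : CovAlg (alpha φ M)) :
    Monotone fun b => ‖h.conjRep b f‖ := by
  rintro b _ ⟨c, rfl⟩
  change ‖h.conjRep b f‖ ≤ ‖h.conjRep (b * c) f‖
  have h1 := norm_le_one_of_star_mul_self (h.isometry c)
  rw [← h.star_S_mul_conjRep_mul_S c, mul_comm c b]
  calc _ ≤ ‖star (S c)‖ * ‖h.conjRep (b * c) f‖ * ‖S c‖ :=
        (norm_mul_le _ _).trans (by gcongr; exact norm_mul_le _ _)
    _ ≤ 1 * ‖h.conjRep (b * c) f‖ * 1 := by rw [norm_star]; gcongr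
    _ = _ := by rw [one_mul, mul_one]

/-- By `covRep_mul` the product inserts `χ_M` between the conjugated factors; undoing the
conjugation by `b` turns it into `χ_{b⁻¹Mb}`. -/
theorem conjRep_single_mul_conjRep_single (h : IsSUFamily φ M S U) (b : HPlus φ M)
    (s t : N ⋊[φ] H) (d e : AlgD φ M) :
    h.conjRep b (single _ s d) * h.conjRep b (single _ t e) =
      h.conjRep b (single _ (s * t) (d * alpha φ M s (unitProj φ M b * e))) := by
  have h1 : ∀ z, alpha φ M (SemidirectProduct.inr (b : H) * s * (SemidirectProduct.inr (b : H))⁻¹)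
      (alpha φ M (SemidirectProduct.inr (b : H)) z) =
      alpha φ M (SemidirectProduct.inr (b : H)) (alpha φ M s z) := fun z => by
    rw [← StarAlgEquiv.mul_apply, ← StarAlgEquiv.mul_apply, ← map_mul, ← map_mul,
      inv_mul_cancel_right]
  rw [conjRep_single, conjRep_single, conjRep_single, ← covRep_mul, mul_assoc, single_mul_single,
    single_mul_single, map_one, StarAlgEquiv.one_apply, ← alpha_unitProj_mul, h1, ← map_mul]
  congr 2
  simp [mul_assoc]

/-- On monomials the error comes from replacing `e` by `χ_{b⁻¹Mb} e` and is at most `‖d‖ ‖e -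
χ_{b⁻¹Mb} e‖`, which tends to zero by the approximate unit. -/
theorem tendsto_conjRep_mul_sub (h : IsSUFamily φ M S U) (f k : CovAlg (alpha φ M)) :
    Tendsto (fun b => h.conjRep b (f * k) - h.conjRep b f * h.conjRep b k) atTop (𝓝 0) := by
  induction f using CovAlg.induction with
  | h0 => simp
  | hadd f f' hf hf' =>
    simpa only [add_mul, map_add, add_sub_add_comm, add_zero] using hf.add hf'
  | hs s d =>
    induction k using CovAlg.induction with
    | h0 => simp
    | hadd k k' hk hk' =>
      simpa only [mul_add, map_add, add_sub_add_comm, add_zero] using hk.add hk'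
    | hs t e =>
      have h1 : Tendsto (fun b => ‖d‖ * ‖e - unitProj φ M b * e‖) atTop (𝓝 0) := by
        have := ((tendsto_unitProj_mul e).const_sub e).norm.const_mul ‖d‖
        rwa [sub_self, norm_zero, mul_zero] at this
      refine squeeze_zero_norm (fun b => ?_) h1
      rw [h.conjRep_single_mul_conjRep_single, single_mul_single, ← map_sub]
      have h2 : single (alpha φ M) (s * t) (d * alpha φ M s e) -
          single _ (s * t) (d * alpha φ M s (unitProj φ M b * e)) =
          single _ (s * t) (d * alpha φ M s (e - unitProj φ M b * e)) := by
        rw [sub_eq_iff_eq_add, ← single_add, ← mul_add, ← map_add, sub_add_cancel]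
      rw [h2]
      refine (h.norm_conjRep_single_le _ _ _).trans ((norm_mul_le _ _).trans ?_)
      rw [norm_alpha]

/-- The C⋆-seminorm `f ↦ sup_b ‖covRep (b f b⁻¹)‖` on `C_c(G, D)`. -/
def supNorm (h : IsSUFamily φ M S U) (f : CovAlg (alpha φ M)) : ℝ := ⨆ b, ‖h.conjRep b f‖

theorem bddAbove_norm_conjRep (h : IsSUFamily φ M S U) (f : CovAlg (alpha φ M)) :
    BddAbove (Set.range fun b => ‖h.conjRep b f‖) :=
  ⟨l1Norm f, by rintro _ ⟨b, rfl⟩; exact h.norm_conjRep_le b f⟩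

theorem tendsto_norm_conjRep (h : IsSUFamily φ M S U) (f : CovAlg (alpha φ M)) :
    Tendsto (fun b => ‖h.conjRep b f‖) atTop (𝓝 (h.supNorm f)) :=
  tendsto_atTop_ciSup (h.monotone_norm_conjRep f) (h.bddAbove_norm_conjRep f)

theorem tendsto_norm_conjRep_mul (h : IsSUFamily φ M S U) (f k : CovAlg (alpha φ M)) :
    Tendsto (fun b => ‖h.conjRep b f * h.conjRep b k‖) atTop (𝓝 (h.supNorm (f * k))) := by
  have h1 : Tendsto (fun b => ‖h.conjRep b (f * k)‖ - ‖h.conjRep b f * h.conjRep b k‖) atTop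
      (𝓝 0) := by
    refine squeeze_zero_norm (fun b => ?_) (tendsto_zero_iff_norm_tendsto_zero.mp
      (h.tendsto_conjRep_mul_sub f k))
    exact abs_norm_sub_norm_le _ _
  simpa only [sub_sub_cancel, sub_zero] using (h.tendsto_norm_conjRep (f * k)).sub h1

/-- `supNorm` as a C⋆-seminorm. -/
def cstarSeminorm (h : IsSUFamily φ M S U) : CStarSeminorm (alpha φ M) :=
  { Seminorm.of h.supNorm
      (fun f k => le_of_tendsto_of_tendsto' (h.tendsto_norm_conjRep (f + k))
        ((h.tendsto_norm_conjRep f).add (h.tendsto_norm_conjRep k)) fun b => by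
          rw [map_add]; exact norm_add_le _ _)
      (fun r f => tendsto_nhds_unique (h.tendsto_norm_conjRep (r • f)) <| by
        simpa only [conjRep_smul, norm_smul] using (h.tendsto_norm_conjRep f).const_mul ‖r‖) with
    -- By monotonicity the supremum is a limit, so submultiplicativity and the C⋆-identity pass from
    -- `B` to the limit although the maps are multiplicative only asymptotically.
    mul_le' := fun f k => le_of_tendsto_of_tendsto' (h.tendsto_norm_conjRep_mul f k)
      ((h.tendsto_norm_conjRep f).mul (h.tendsto_norm_conjRep k)) fun b => norm_mul_le _ _
    star_mul_self' := fun f =>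
      tendsto_nhds_unique (h.tendsto_norm_conjRep_mul (star f) f) <| by
        have := (h.tendsto_norm_conjRep f).pow 2
        simp only [conjRep_star, CStarRing.norm_star_mul_self, ← sq]
        exact this
    le_l1Norm' := fun f => ciSup_le fun b => h.norm_conjRep_le b f }

/-- `covRep` is the member `b = 1` of the family whose supremum is a C⋆-seminorm. -/
theorem norm_covRep_le (h : IsSUFamily φ M S U) (f : CovAlg (alpha φ M)) :
    ‖h.covRep f‖ ≤ ‖f‖ := by
  rw [← h.conjRep_one]
  exact (le_ciSup (h.bddAbove_norm_conjRep f) 1).trans (le_univNorm h.cstarSeminorm f)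

/-- `covRep` as a bounded linear map. -/
def covRepL (h : IsSUFamily φ M S U) : CovAlg (alpha φ M) →L[ℂ] B :=
  LinearMap.mkContinuous { h.covRep with map_smul' := h.covRep_smul } 1
    fun f => by rw [one_mul]; exact h.norm_covRep_le f

/-- The extension of `covRep` to the crossed product. -/
def crossedRep (h : IsSUFamily φ M S U) : algA φ M →L[ℂ] B :=
  h.covRepL.extend CrossedProduct.of

theorem crossedRep_of (h : IsSUFamily φ M S U) (f : CovAlg (alpha φ M)) :
    h.crossedRep (CrossedProduct.of f) = h.covRep f :=
  ContinuousLinearMap.extend_eq _ CrossedProduct.denseRange_of CrossedProduct.isUniformInducing_of f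

theorem crossedRep_mul (h : IsSUFamily φ M S U) (x y : algA φ M) :
    h.crossedRep (x * projP φ M * y) = h.crossedRep x * h.crossedRep y := by
  refine CrossedProduct.induction₂ x y (isClosed_eq (by fun_prop) (by fun_prop)) fun f k => ?_
  rw [projP, CrossedProduct.iD_apply, ← CrossedProduct.of_mul, ← CrossedProduct.of_mul,
    crossedRep_of, crossedRep_of, crossedRep_of, covRep_mul]

theorem crossedRep_star (h : IsSUFamily φ M S U) (x : algA φ M) :
    h.crossedRep (star x) = star (h.crossedRep x) := by
  refine CrossedProduct.induction₁ x (isClosed_eq (by fun_prop) (by fun_prop)) fun f => ?_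
  rw [← CrossedProduct.of_star, crossedRep_of, crossedRep_of, covRep_star]

/-- The homomorphism of the corner associated with an SU-family. -/
def cornerRep (h : IsSUFamily φ M S U) : cornerA φ M →⋆ₙₐ[ℂ] B where
  toFun x := h.crossedRep (x : algA φ M)
  map_smul' r x := map_smul h.crossedRep r (x : algA φ M)
  map_zero' := map_zero h.crossedRep
  map_add' x y := map_add h.crossedRep (x : algA φ M) y
  map_mul' x y := by
    -- In the corner `x p = x`, so the inserted `p` is invisible.
    rw [← h.crossedRep_mul, x.2.2]
    rfl
  map_star' x := h.crossedRep_star x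

end IsSUFamily

/-! ### The SU-family in the corner and generation -/

section CornerFamily

open CovAlg CrossedProduct

section

variable {N H : Type*} [Group N] [Group H] {φ : H →* MulAut N} {M : Subgroup N}

/-- The element `pgp` of the corner, for `g ∈ N ⋊ H`. -/
def cornerW (φ : H →* MulAut N) (M : Subgroup N) (g : N ⋊[φ] H) : cornerA φ M :=
  Corner.compress _ _ (iG (alpha φ M) g)

theorem cornerS_eq_cornerW (a : HPlus φ M) :
    cornerS φ M a = cornerW φ M (SemidirectProduct.inr (a : H)) := rfl

theorem cornerU_eq_cornerW (m : M) :
    cornerU φ M m = cornerW φ M (SemidirectProduct.inl (m : N)) := rfl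

theorem chiM_mul_self : chiM φ M * chiM φ M = chiM φ M :=
  (isStarProjection_chiM φ M).isIdempotentElem

theorem star_chiM : star (chiM φ M) = chiM φ M := (isStarProjection_chiM φ M).isSelfAdjoint

theorem projP_eq : projP φ M = of (single (alpha φ M) 1 (chiM φ M)) := rfl

theorem alpha_chiM_mul_self (g : N ⋊[φ] H) :
    alpha φ M g (chiM φ M) * alpha φ M g (chiM φ M) = alpha φ M g (chiM φ M) := by
  rw [← map_mul, chiM_mul_self]

theorem coe_cornerW (g : N ⋊[φ] H) :
    (cornerW φ M g : algA φ M) = of (single _ g (chiM φ M * alpha φ M g (chiM φ M))) := by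
  change projP φ M * (iG (alpha φ M) g).fst (projP φ M) * projP φ M = _
  rw [projP_eq, iG_fst_of, leftAdd_single, ← of_mul, ← of_mul, single_mul_single, single_mul_single,
    mul_one, one_mul, mul_one, map_one, StarAlgEquiv.one_apply, mul_assoc, alpha_chiM_mul_self]

theorem cornerW_one : cornerW φ M 1 = 1 := by
  refine Subtype.ext ?_
  rw [coe_cornerW, map_one, StarAlgEquiv.one_apply, chiM_mul_self]
  rfl

theorem star_cornerW (g : N ⋊[φ] H) : star (cornerW φ M g) = cornerW φ M g⁻¹ := by
  refine Subtype.ext ?_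
  change star (cornerW φ M g : algA φ M) = _
  rw [coe_cornerW, coe_cornerW, ← of_star, star_single, star_mul, ← map_star, star_chiM, map_mul,
    ← StarAlgEquiv.mul_apply, ← map_mul, inv_mul_cancel, map_one, StarAlgEquiv.one_apply]

theorem chiM_mul_alpha_chiM {k : N ⋊[φ] H} (hk : k.left ∈ M) (hk' : k.right ∈ HPlus φ M) :
    chiM φ M * alpha φ M k (chiM φ M) = alpha φ M k (chiM φ M) := by
  classical
  refine AlgD.ext fun y => ?_
  rw [alpha_chiM, chiM_eq_cosetChi, map_mul]
  change AlgD.incl φ M _ y * AlgD.incl φ M _ y = _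
  rw [incl_cosetChi, incl_cosetChi]
  by_cases hy : k.left⁻¹ * y ∈ conjSubgroup φ M k.right
  · have h1 : y ∈ M := by
      have := M.mul_mem hk (hk' hy)
      rwa [mul_inv_cancel_left] at this
    rw [if_pos hy, if_pos, mul_one]
    simpa [mem_conjSubgroup] using h1
  · rw [if_neg hy, mul_zero]

/-- Such a `k` maps `M` into itself, so `kpk⁻¹ ≤ p` and `pkp = kp`; hence `pgp · pkp = pgkp`. -/
theorem cornerW_mul (g : N ⋊[φ] H) {k : N ⋊[φ] H} (hk : k.left ∈ M) (hk' : k.right ∈ HPlus φ M) :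
    cornerW φ M g * cornerW φ M k = cornerW φ M (g * k) := by
  refine Subtype.ext ?_
  change (cornerW φ M g : algA φ M) * (cornerW φ M k : algA φ M) = _
  rw [coe_cornerW, coe_cornerW, coe_cornerW, ← of_mul, single_mul_single, mul_assoc, ← map_mul,
    ← mul_assoc (chiM φ M), chiM_mul_self, chiM_mul_alpha_chiM hk hk', map_mul,
    StarAlgEquiv.mul_apply]

/-- The compression `d ↦ pdp` of `D` to the corner. -/
def cornerD (φ : H →* MulAut N) (M : Subgroup N) : AlgD φ M →⋆ₙₐ[ℂ] cornerA φ M where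
  toFun d := ⟨iD (alpha φ M) (chiM φ M * d), by
    constructor
    · rw [projP, ← map_mul, ← mul_assoc, chiM_mul_self]
    · rw [projP, ← map_mul, AlgD.mul_comm, ← mul_assoc, chiM_mul_self]⟩
  map_smul' r d := Subtype.ext <| by
    change iD _ (_ * r • d) = r • iD (alpha φ M) (_ * d)
    rw [mul_smul_comm, map_smul]
  map_zero' := Subtype.ext <| by
    change iD (alpha φ M) (_ * 0) = 0
    rw [mul_zero, map_zero]
  map_add' d e := Subtype.ext <| by
    change iD _ (_ * (d + e)) = iD (alpha φ M) (_ * d) + iD (alpha φ M) (_ * e)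
    rw [mul_add, map_add]
  map_mul' d e := Subtype.ext <| by
    change iD _ (_ * (d * e)) = iD (alpha φ M) (_ * d) * iD (alpha φ M) (_ * e)
    rw [← map_mul, AlgD.mul_comm _ d, mul_assoc, ← mul_assoc (chiM φ M) (chiM φ M), chiM_mul_self,
      ← mul_assoc, ← mul_assoc, AlgD.mul_comm d]
  map_star' d := Subtype.ext <| by
    change iD _ (_ * star d) = star (iD (alpha φ M) (_ * d))
    rw [← map_star, star_mul, star_chiM, AlgD.mul_comm]

theorem coe_cornerD (d : AlgD φ M) :
    (cornerD φ M d : algA φ M) = of (single _ 1 (chiM φ M * d)) := rfl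

theorem cornerD_chiM : cornerD φ M (chiM φ M) = 1 := by
  refine Subtype.ext ?_
  rw [coe_cornerD, chiM_mul_self]
  rfl

theorem cornerW_mul_cornerW_inv (g : N ⋊[φ] H) :
    cornerW φ M g * cornerW φ M g⁻¹ = cornerD φ M (alpha φ M g (chiM φ M)) := by
  refine Subtype.ext ?_
  change (cornerW φ M g : algA φ M) * (cornerW φ M g⁻¹ : algA φ M) = _
  rw [coe_cornerW, coe_cornerW, coe_cornerD, ← of_mul, single_mul_single, mul_inv_cancel, map_mul,
    ← StarAlgEquiv.mul_apply, ← map_mul, mul_inv_cancel, map_one, StarAlgEquiv.one_apply, mul_assoc,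
    ← mul_assoc (alpha φ M g _), alpha_chiM_mul_self, AlgD.mul_comm _ (chiM φ M), ← mul_assoc,
    chiM_mul_self]

theorem cosetInvariant_mul_cosetChi {a : H} {d : AlgD φ M}
    (hd : ∀ n, ∀ k ∈ conjSubgroup φ M a, AlgD.incl φ M d (n * k) = AlgD.incl φ M d n) (m : N) :
    d * cosetChi φ M m a = AlgD.incl φ M d m • cosetChi φ M m a := by
  classical
  refine AlgD.ext fun y => ?_
  rw [map_mul, map_smul]
  change AlgD.incl φ M _ y * AlgD.incl φ M _ y = AlgD.incl φ M d m * AlgD.incl φ M _ y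
  rw [incl_cosetChi]
  by_cases hy : m⁻¹ * y ∈ conjSubgroup φ M a
  · have := hd m _ hy
    rw [mul_inv_cancel_left] at this
    rw [this]
  · rw [if_neg hy, mul_zero, mul_zero]

end

variable {N H : Type*} [Group N] [CommGroup H] {φ : H →* MulAut N} {M : Subgroup N}

/-- By `cornerW_mul`, `u(m) s_a = pgp` with `g = ma`, and the range projection of this isometry is
`p · gpg⁻¹ = p χ_{m aMa⁻¹}`. -/
theorem cornerRangeProj (m : M) (a : HPlus φ M) :
    cornerU φ M m * cornerS φ M a * star (cornerS φ M a) * cornerU φ M m⁻¹ =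
      cornerD φ M (cosetChi φ M m a) := by
  have h1 : star (cornerS φ M a) * cornerU φ M m⁻¹ =
      cornerW φ M (SemidirectProduct.inl (m : N) * SemidirectProduct.inr (a : H))⁻¹ := by
    rw [cornerS_eq_cornerW, star_cornerW, cornerU_eq_cornerW, cornerW_mul _ (by simp) (by simp)]
    congr 1
    simp
  rw [mul_assoc, h1, cornerS_eq_cornerW, cornerU_eq_cornerW, cornerW_mul _ (by simp) (by simp),
    cornerW_mul_cornerW_inv, alpha_chiM]
  simp

/-- The C⋆-subalgebra of the corner generated by the elements `s_a` and `u(m)`. -/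
def cornerGen (φ : H →* MulAut N) (M : Subgroup N) : StarSubalgebra ℂ (cornerA φ M) :=
  (StarAlgebra.adjoin ℂ
    (Set.range (cornerS φ M) ∪ Set.range (cornerU φ M))).topologicalClosure

theorem cornerS_mem_cornerGen (a : HPlus φ M) : cornerS φ M a ∈ cornerGen φ M :=
  StarSubalgebra.le_topologicalClosure _ (StarAlgebra.subset_adjoin ℂ _ (Or.inl ⟨a, rfl⟩))

theorem cornerU_mem_cornerGen (m : M) : cornerU φ M m ∈ cornerGen φ M :=
  StarSubalgebra.le_topologicalClosure _ (StarAlgebra.subset_adjoin ℂ _ (Or.inr ⟨m, rfl⟩))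

theorem isClosed_cornerGen : IsClosed (cornerGen φ M : Set (cornerA φ M)) :=
  StarSubalgebra.isClosed_topologicalClosure _

variable [hdir : IsExhausting φ M]

theorem sum_cosetChi (a : HPlus φ M) :
    ∑ c : M ⧸ (conjHom φ M a).range, cosetChi φ M ((Quotient.out c : M) : N) a = chiM φ M := by
  classical
  refine AlgD.ext fun y => ?_
  rw [map_sum, chiM_eq_cosetChi, incl_cosetChi, lp.coeFn_sum, Finset.sum_apply]
  simp only [incl_cosetChi]
  by_cases hy : y ∈ M
  · rw [if_pos (by simpa [mem_conjSubgroup] using hy),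
      Finset.sum_eq_single ((⟨y, hy⟩ : M) : M ⧸ (conjHom φ M a).range), if_pos]
    · have := QuotientGroup.eq.mp
        (QuotientGroup.out_eq' ((⟨y, hy⟩ : M) : M ⧸ (conjHom φ M a).range))
      simpa using mem_range_conjHom.mp this
    · intro c _ hc
      rw [if_neg]
      intro h1
      refine hc ?_
      rw [← QuotientGroup.out_eq' c]
      exact QuotientGroup.eq.mpr (mem_range_conjHom.mpr h1)
    · simp
  · rw [if_neg (by simpa [mem_conjSubgroup] using hy)]
    refine Finset.sum_eq_zero fun c _ => ?_
    rw [if_neg]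
    intro h1
    have := M.mul_mem (Quotient.out c).2 (a.2 h1)
    rw [mul_inv_cancel_left] at this
    exact hy this

/-- In each relation but the sum, the right factors of the products come from `M` or `H⁺`, where `g
↦ pgp` is multiplicative. The sum relation is the partition of `M` into cosets of `aMa⁻¹`. -/
theorem isSUFamily_corner : IsSUFamily φ M (cornerS φ M) (cornerU φ M) where
  isometry a := by
    rw [cornerS_eq_cornerW, star_cornerW, cornerW_mul _ (by simp) (by simp), inv_mul_cancel,
      cornerW_one]
  unitary m := by
    rw [cornerU_eq_cornerW, Unitary.mem_iff, star_cornerW, cornerW_mul _ (by simp) (by simp),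
      cornerW_mul _ (by simp) (by simp), inv_mul_cancel, mul_inv_cancel, cornerW_one]
    exact ⟨rfl, rfl⟩
  S_mul_S a b := by
    rw [cornerS_eq_cornerW, cornerS_eq_cornerW, cornerW_mul _ (by simp) (by simp), ← map_mul]
    rfl
  S_mul_U a m := by
    rw [cornerS_eq_cornerW, cornerU_eq_cornerW, cornerU_eq_cornerW,
      cornerW_mul _ (by simp) (by simp), cornerW_mul _ (by simp) (by simp)]
    congr 1
    ext <;> simp
  sum_eq_one a := by
    rw [finsum_eq_sum_of_fintype]
    simp only [cornerRangeProj]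
    rw [← cornerD_chiM, ← sum_cosetChi a, map_sum]
  U_mul_U m k := by
    rw [cornerU_eq_cornerW, cornerU_eq_cornerW, cornerW_mul _ (by simp) (by simp), ← map_mul]
    rfl

theorem cornerW_mem_cornerGen (g : N ⋊[φ] H) : cornerW φ M g ∈ cornerGen φ M := by
  obtain ⟨b, m, c, rfl⟩ := exists_fracWord (M := M) g
  rw [fracWord, ← cornerW_mul _ (by simp) (by simp), ← cornerW_mul _ (by simp) (by simp), map_inv,
    ← star_cornerW]
  exact mul_mem (mul_mem (star_mem (cornerS_mem_cornerGen b)) (cornerU_mem_cornerGen m))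
    (cornerS_mem_cornerGen c)

/-- This exhibits `p χ_{xaMa⁻¹}` as a finite combination of words in the generators: both sides act
by the same scalar on each `χ_{m eMe⁻¹}`, `m ∈ M`. -/
theorem cornerD_cosetChi (x : N) {a : H} {e : HPlus φ M}
    (he : conjSubgroup φ M (e : H) ≤ conjSubgroup φ M a) :
    cornerD φ M (cosetChi φ M x a) =
      isSUFamily_corner.stepRep e (AlgD.incl φ M (cosetChi φ M x a)) := by
  refine isSUFamily_corner.ext_rangeProj e fun m => ?_
  rw [isSUFamily_corner.stepRep_mul_rangeProj (cosetInvariant_cosetChi x he), IsSUFamily.rangeProj,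
    cornerRangeProj, ← map_mul, cosetInvariant_mul_cosetChi (cosetInvariant_cosetChi x he),
    map_smul]

theorem cornerD_mem_cornerGen (d : AlgD φ M) : cornerD φ M d ∈ cornerGen φ M := by
  have hc : Continuous (cornerD φ M) :=
    AddMonoidHomClass.continuous_of_bound (cornerD φ M) 1 fun d => by
      rw [one_mul]; exact NonUnitalStarAlgHom.norm_apply_le (cornerD φ M) d
  induction d using AlgD.induction with
  | hc => exact isClosed_cornerGen.preimage hc
  | hgen x a =>
    obtain ⟨e, he⟩ := hdir.exists_inv_mul_mem a
    rw [cornerD_cosetChi x (inv_mul_mem_HPlus.mp he), IsSUFamily.stepRep_apply]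
    refine sum_mem fun c _ => SMulMemClass.smul_mem _ ?_
    exact mul_mem (mul_mem (mul_mem (cornerU_mem_cornerGen _) (cornerS_mem_cornerGen _))
      (star_mem (cornerS_mem_cornerGen _))) (cornerU_mem_cornerGen _)
  | hzero => rw [map_zero]; exact zero_mem _
  | hadd d e hd he => rw [map_add]; exact add_mem hd he
  | hmul d e hd he => rw [map_mul]; exact mul_mem hd he
  | hsmul r d hd => rw [map_smul]; exact SMulMemClass.smul_mem _ hd
  | hstar d hd => rw [map_star]; exact star_mem hd

theorem projP_mul_mul_projP_mem (x : algA φ M) :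
    projP φ M * x * projP φ M ∈ Subtype.val '' (cornerGen φ M : Set (cornerA φ M)) := by
  have hcl : IsClosed (Subtype.val '' (cornerGen φ M : Set (cornerA φ M)) : Set (algA φ M)) :=
    (Corner.isClosed (hp := isStarProjection_projP φ M)).isClosedEmbedding_subtypeVal.isClosedMap _
      isClosed_cornerGen
  refine induction₁ x (hcl.preimage (by fun_prop)) fun f => ?_
  induction f using CovAlg.induction with
  | h0 => exact ⟨0, zero_mem _, by simp⟩
  | hadd f k hf hk =>
    obtain ⟨y, hy, hy'⟩ := hf
    obtain ⟨z, hz, hz'⟩ := hk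
    refine ⟨y + z, add_mem hy hz, ?_⟩
    rw [map_add, mul_add, add_mul, ← hy', ← hz']
    rfl
  | hs g d =>
    -- `p` commutes with `d`, so `(pdp)(pgp) = p(dg)p`.
    refine ⟨cornerD φ M d * cornerW φ M g,
      mul_mem (cornerD_mem_cornerGen d) (cornerW_mem_cornerGen g), ?_⟩
    change (cornerD φ M d : algA φ M) * (cornerW φ M g : algA φ M) = _
    rw [coe_cornerD, coe_cornerW, projP_eq, ← of_mul, ← of_mul, ← of_mul, single_mul_single,
      single_mul_single, single_mul_single, one_mul, mul_one, map_one, StarAlgEquiv.one_apply,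
      StarAlgEquiv.one_apply, AlgD.mul_comm (chiM φ M) d, mul_assoc, ← mul_assoc (chiM φ M),
      chiM_mul_self, ← mul_assoc]

theorem cornerGen_eq_top : cornerGen φ M = ⊤ := by
  refine eq_top_iff.mpr fun x _ => ?_
  obtain ⟨y, hy, hyx⟩ := projP_mul_mul_projP_mem (x : algA φ M)
  rw [x.2.1, x.2.2] at hyx
  rwa [← Subtype.ext hyx]

theorem cornerHom_ext {B : Type*} [CStarAlgebra B] {F F' : cornerA φ M →⋆ₙₐ[ℂ] B}
    (hS : ∀ a, F (cornerS φ M a) = F' (cornerS φ M a))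
    (hU : ∀ m, F (cornerU φ M m) = F' (cornerU φ M m)) : F = F' := by
  have hF : ∀ F : cornerA φ M →⋆ₙₐ[ℂ] B, Continuous F := fun F =>
    AddMonoidHomClass.continuous_of_bound F 1 fun d => by
      rw [one_mul]; exact NonUnitalStarAlgHom.norm_apply_le F d
  -- The homomorphisms need not be unital, so scalars are compared through `1 = u(1)`.
  have hone : F 1 = F' 1 := by
    rw [← isSUFamily_corner.U_one]
    exact hU 1
  have hcl : IsClosed {x | F x = F' x} := isClosed_eq (hF F) (hF F')
  have hsub : ((StarAlgebra.adjoin ℂ (Set.range (cornerS φ M) ∪ Set.range (cornerU φ M)) :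
      StarSubalgebra ℂ (cornerA φ M)) : Set (cornerA φ M)) ⊆ {x | F x = F' x} := by
    intro x hx
    induction hx using StarAlgebra.adjoin_induction with
    | mem x hx =>
      obtain ⟨a, rfl⟩ | ⟨m, rfl⟩ := hx
      exacts [hS a, hU m]
    | algebraMap r =>
      change F _ = F' _
      rw [Algebra.algebraMap_eq_smul_one, map_smul, map_smul, hone]
    | add x y _ _ hx hy =>
      exact (map_add F x y).trans ((congrArg₂ _ hx hy).trans (map_add F' x y).symm)
    | mul x y _ _ hx hy =>
      exact (map_mul F x y).trans ((congrArg₂ _ hx hy).trans (map_mul F' x y).symm)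
    | star x _ hx => exact (map_star F x).trans ((congrArg _ hx).trans (map_star F' x).symm)
  refine NonUnitalStarAlgHom.ext fun x => ?_
  have hx : x ∈ cornerGen φ M := by rw [cornerGen_eq_top]; trivial
  exact closure_minimal hsub hcl hx

/-- As `pgp = p α_g(p) g`, its image is `rep (α_g χ_M) * W_g = W_g * rep χ_M = W_g`. -/
theorem IsSUFamily.cornerRep_cornerW {B : Type*} [CStarAlgebra B] {S : HPlus φ M → B} {U : M → B}
    (h : IsSUFamily φ M S U) (g : N ⋊[φ] H) : h.cornerRep (cornerW φ M g) = h.partialRep g := by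
  change h.crossedRep (cornerW φ M g : algA φ M) = _
  rw [coe_cornerW, h.crossedRep_of, h.covRep_single, map_mul, h.rep_chiM, one_mul,
    ← h.partialRep_mul_rep, h.rep_chiM, mul_one]

end CornerFamily

end

/-! ### The universal property of the corner -/

theorem mainTheorem3 {N : Type*} {H : Type*} [Group N] [CommGroup H] (φ : H →* MulAut N)
    (M : Subgroup N) [M.Normal] (hM : M ≠ ⊥)
    (hbase : ∀ U ∈ conjFamily φ M, ∀ V ∈ conjFamily φ M, ∃ W ∈ conjFamily φ M, W ≤ U ⊓ V)
    (hsep : (⨅ U ∈ conjFamily φ M, U) = ⊥)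
    (hfin : ∀ U ∈ conjFamily φ M, ∀ V ∈ conjFamily φ M, V ≤ U → Finite (U ⧸ V.subgroupOf U))
    (hN : (⋃ a : HPlus φ M, (conjSubgroup φ M (a : H)⁻¹ : Set N)) = Set.univ) :
    IsSUFamily φ M (cornerS φ M) (cornerU φ M) ∧
    (StarAlgebra.adjoin ℂ (Set.range (cornerS φ M) ∪ Set.range (cornerU φ M))).topologicalClosure
      = ⊤ ∧
    ∀ {B : Type*} [CStarAlgebra B] (S : HPlus φ M → B) (U : M → B), IsSUFamily φ M S U →
      ∃! F : cornerA φ M →⋆ₙₐ[ℂ] B,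
        (∀ a, F (cornerS φ M a) = S a) ∧ ∀ m, F (cornerU φ M m) = U m := by
  have : IsExhausting φ M := .of_conjFamily hbase hfin hN
  refine ⟨isSUFamily_corner, cornerGen_eq_top, fun {B} _ S U h => ?_⟩
  have hS : ∀ a, h.cornerRep (cornerS φ M a) = S a := fun a => by
    rw [cornerS_eq_cornerW, h.cornerRep_cornerW, h.partialRep_inr]
  have hU : ∀ m, h.cornerRep (cornerU φ M m) = U m := fun m => by
    rw [cornerU_eq_cornerW, h.cornerRep_cornerW, h.partialRep_inl]
  refine ⟨h.cornerRep, ⟨hS, hU⟩, fun F hF => cornerHom_ext (fun a => ?_) fun m => ?_⟩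
  · rw [hF.1, hS]
  · rw [hF.2, hU]
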